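/- For $h\in\mathbb{Q}$ let $E_h(\mathbb{Q})$ be the set of rational points $[x:y:z]$ of the projective plane cubic $(x+z)(y+z)(x+y+z)=h\,xyz$, whose affine part is $(x+1)(y+1)(x+y+1)=h\,xy$. When this cubic is smooth, $E_h(\mathbb{Q})$ is an abelian group under the secant–tangent chord process with neutral element $\mathcal{O}=[1:-1:0]$: three points $P,Q,R$ satisfy $P+Q+R=\mathcal{O}$ if and only if they are the intersection points, counted with multiplicity, of the cubic with a line. Let $h_c^+=(11+5\sqrt5)/2\simeq 11.09$. Then: 1. there exist rational values $h>h_c^+$ for which $E_h(\mathbb{Q})$ has rank $0$; 2. for example, $13>h_c^+$, the group $E_{13}(\mathbb{Q})$ has rank $0$, and $E_{13}(\mathbb{Q})\cong\mathbb{Z}/5\mathbb{Z}$; 3. consequently the answer to the question of Bastien and Rogalski, "is the rank of $E_h(\mathbb{Q})$ positive for every $h\in\mathbb{Q}$ with $h>h_c^+$?", is negative. -/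

import Mathlib

open scoped LinearAlgebra.Projectivization

namespace Lyness

/-- The homogeneous form of `(x + 1) (y + 1) (x + y + 1) - h x y` in the coordinates
`[x : y : z] = [p 0 : p 1 : p 2]`. -/
def cubic (h : ℚ) (p : Fin 3 → ℚ) : ℚ :=
  (p 0 + p 2) * (p 1 + p 2) * (p 0 + p 1 + p 2) - h * p 0 * p 1 * p 2

theorem cubic_smul (h c : ℚ) (p : Fin 3 → ℚ) : cubic h (c • p) = c ^ 3 * cubic h p := by
  simp only [cubic, Pi.smul_apply, smul_eq_mul]
  ring

/-- The affine part `z = 1` is the curve `(x + 1) (y + 1) (x + y + 1) = h x y`. -/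
theorem cubic_affine (h x y : ℚ) :
    cubic h ![x, y, 1] = 0 ↔ (x + 1) * (y + 1) * (x + y + 1) = h * x * y := by
  simp [cubic, sub_eq_zero]

/-- `E h` is the set `E_h(ℚ)` of rational points of the projective cubic
`(x + z) (y + z) (x + y + z) = h x y z`. -/
def E (h : ℚ) : Type :=
  {P : ℙ ℚ (Fin 3 → ℚ) // ∀ p ∈ P.submodule, cubic h p = 0}

/-- The point `[1 : -1 : 0]` of `E_h`. -/
def O (h : ℚ) : E h :=
  ⟨Projectivization.mk ℚ ![1, -1, 0] (fun H => by simpa using congrFun H 0), by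
    intro p hp
    rw [Projectivization.submodule_mk, Submodule.mem_span_singleton] at hp
    obtain ⟨c, rfl⟩ := hp
    rw [cubic_smul]
    simp [cubic]⟩

/-- `LineMeets h P Q R`: some line of the projective plane over `ℚ` meets the cubic exactly in
`P`, `Q`, `R`, counted with multiplicity. The line is `{[s u + t v]}` with `u`, `v` linearly
independent, the three points have the parameters `[s : t] = [a 0 : a 1], [b 0 : b 1], [c 0 : c 1]`,
and the restriction of the cubic form to the line is a nonzero multiple of the product of the three
linear forms that vanish at these parameters. -/
def LineMeets (h : ℚ) (P Q R : E h) : Prop :=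
  ∃ u v : Fin 3 → ℚ, LinearIndependent ℚ ![u, v] ∧
    ∃ a b c : Fin 2 → ℚ, a ≠ 0 ∧ b ≠ 0 ∧ c ≠ 0 ∧
      a 0 • u + a 1 • v ∈ P.1.submodule ∧
      b 0 • u + b 1 • v ∈ Q.1.submodule ∧
      c 0 • u + c 1 • v ∈ R.1.submodule ∧
      ∃ k : ℚ, k ≠ 0 ∧ ∀ s t : ℚ, cubic h (s • u + t • v) =
        k * (s * a 1 - t * a 0) * (s * b 1 - t * b 0) * (s * c 1 - t * c 0)

/-- An abelian group structure on `E_h(ℚ)` is given by the secant-tangent chord process when its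
neutral element is `[1 : -1 : 0]` and three points add up to zero if and only if they are the
intersection of the cubic with a line. -/
def IsChordTangentLaw (h : ℚ) (G : AddCommGroup (E h)) : Prop :=
  (0 : E h) = O h ∧ ∀ P Q R : E h, P + Q + R = 0 ↔ LineMeets h P Q R

/-- There is at most one such group structure. -/
theorem IsChordTangentLaw.unique {h : ℚ} {G₁ G₂ : AddCommGroup (E h)}
    (h₁ : IsChordTangentLaw h G₁) (h₂ : IsChordTangentLaw h G₂) : G₁ = G₂ := by
  have key : ∀ P Q R : E h, G₁.add (G₁.add P Q) R = G₁.zero ↔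
      G₂.add (G₂.add P Q) R = G₂.zero := fun P Q R => (h₁.2 P Q R).trans (h₂.2 P Q R).symm
  have hz : G₁.zero = G₂.zero := h₁.1.trans h₂.1.symm
  have hneg : ∀ P : E h, G₁.neg P = G₂.neg P := by
    intro P
    have e1 : G₁.add (G₁.add P (G₁.neg P)) G₁.zero = G₁.zero := by
      let _ := G₁
      change P + -P + 0 = 0
      simp
    have e2 := (key _ _ _).1 e1
    rw [hz] at e2
    let _ := G₂
    change P + G₁.neg P + 0 = 0 at e2
    change G₁.neg P = -P
    rw [add_zero] at e2
    exact (neg_eq_of_add_eq_zero_right e2).symm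
  apply AddCommGroup.ext
  funext P Q
  have e1 : G₁.add (G₁.add P Q) (G₁.neg (G₁.add P Q)) = G₁.zero := by
    let _ := G₁
    exact add_neg_cancel (P + Q)
  have e2 := (key _ _ _).1 e1
  rw [hneg] at e2
  change G₁.add P Q = G₂.add P Q
  let _ := G₂
  change P + Q + -(G₁.add P Q) = 0 at e2
  exact (add_neg_eq_zero.1 e2).symm

/-- The value `h_c^+ = (11 + 5 √5) / 2`. -/
noncomputable def hcPlus : ℝ := (11 + 5 * Real.sqrt 5) / 2

end Lyness

/-!
A rational point `(x, y)` with `x y ≠ 0` on the affine cubic with `h = 13` is a pair of consecutive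
terms of a cycle `x i * x (i + 2) = 1 + x (i + 1)` of length five whose terms have product `13`.
Writing the terms in lowest terms, the denominators split into pairwise coprime pieces
`d 0, …, d 4`, and these are, up to sign, the coordinates of an integral point `a` with `a 0 ≠ 0` on
a curve in `ℙ⁴`, the covering attached to an isogeny with kernel `μ₅`. Four of the five hyperplane
sections `5 P j` of the covering are conjugate over `ℤ[z]`, `z ^ 5 = 1`, and the fifth is rational.
As `ℤ[z]` is a principal ideal ring in which a unit differs from its complex conjugate by a root of
unity, a study of these sections at the primes above `5` and `13` shows that each of them is a
constant times a fifth power. Their fifth roots lie on the covering of the dual isogeny, and linear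
forms in them yield a new Lyness cycle with product `13`, whose common denominator divides `a 0`.
This descent excludes `a 0 ≠ 0`, so only the five points with `x y z = 0` remain on the projective
cubic; the chords through them are those of `ℤ/5`.
-/

namespace Lyness

section Covering

variable {R : Type*} [CommRing R]

/-- The affine cone over a curve of genus one and degree five in `ℙ⁴` that covers the cubic
`E_13` through an isogeny with kernel `μ₅`. -/
structure Covering (a : Fin 5 → R) : Prop where
  e0 : a 1 * a 4 - a 2 * a 3 - 13 * a 0 ^ 2 = 0
  e1 : a 2 ^ 2 - a 1 * a 3 + 13 * a 0 * a 4 = 0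
  e2 : a 4 ^ 2 - a 1 * a 2 - a 0 * a 3 = 0
  e3 : a 1 ^ 2 - a 3 * a 4 + a 0 * a 2 = 0
  e4 : a 3 ^ 2 - a 2 * a 4 - 13 * a 0 * a 1 = 0

/-- The action of `μ₅` on the covering. The point `P j` referred to below is
`[0 : 1 : w⁻¹ : w⁻² : w⁻³]` with `w = z ^ j`, where `z` is a fixed primitive fifth root of unity;
the hyperplane `a 0 = 0` cuts out `P 0 + P 1 + P 2 + P 3 + P 4`. -/
def twist (w : R) (a : Fin 5 → R) : Fin 5 → R :=
  ![a 0, w * a 1, w ^ 2 * a 2, w ^ 3 * a 3, w ^ 4 * a 4]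

/-- The hyperplane section `5 P 0` of the covering. -/
def flex (a : Fin 5 → R) : R := 14 * a 0 + 5 * (a 1 - a 4) + 3 * (a 2 - a 3)

/-- The hyperplane section `3 P 0 + P 2 + P 3` of the covering if `f = -(z ^ 2 + z ^ 3)`, and
`3 P 0 + P 1 + P 4` if `f = -(z + z ^ 4)`. -/
def tri (f : R) (a : Fin 5 → R) : R :=
  (6 + 4 * f) * a 0 + (1 + 2 * f) * (a 1 - a 4) + (1 + f) * (a 2 - a 3)

/-- The hyperplane section `P 0 + 2 P 2 + 2 P 3` of the covering if `f = -(z ^ 2 + z ^ 3)`, and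
`P 0 + 2 P 1 + 2 P 4` if `f = -(z + z ^ 4)`. -/
def dbl (f : R) (a : Fin 5 → R) : R := (5 * f - 3) * a 0 + f * (a 1 - a 4) + (a 2 - a 3)

theorem twist_twist (v w : R) (a : Fin 5 → R) : twist v (twist w a) = twist (v * w) a := by
  ext j
  fin_cases j <;> simp [twist] <;> ring

theorem one_twist (a : Fin 5 → R) : twist 1 a = a := by
  ext j
  fin_cases j <;> simp [twist]

section Map

variable {S F : Type*} [CommRing S] [FunLike F R S] [RingHomClass F R S] (g : F)

theorem map_twist (w : R) (a : Fin 5 → R) : g ∘ twist w a = twist (g w) (g ∘ a) := by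
  ext j
  fin_cases j <;> simp [twist]

theorem map_flex (a : Fin 5 → R) : g (flex a) = flex (g ∘ a) := by
  simp [flex, map_ofNat g]

theorem map_tri (f : R) (a : Fin 5 → R) : g (tri f a) = tri (g f) (g ∘ a) := by
  simp [tri, map_ofNat g]

theorem map_dbl (f : R) (a : Fin 5 → R) : g (dbl f a) = dbl (g f) (g ∘ a) := by
  simp [dbl, map_ofNat g]

theorem Covering.map {a : Fin 5 → R} (h : Covering a) : Covering (g ∘ a) where
  e0 := by simpa [map_ofNat g 13] using congrArg g h.e0
  e1 := by simpa [map_ofNat g 13] using congrArg g h.e1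
  e2 := by simpa using congrArg g h.e2
  e3 := by simpa using congrArg g h.e3
  e4 := by simpa [map_ofNat g 13] using congrArg g h.e4

end Map

theorem flex_eq_tri {f : R} (hf : f ^ 2 - f - 1 = 0) (a : Fin 5 → R) :
    (2 * f - 1) * flex a = f ^ 2 * tri f a - (1 - f) ^ 2 * tri (1 - f) a := by
  simp only [flex, tri]
  grind

namespace Covering

variable {a : Fin 5 → R}

theorem twist (h : Covering a) {w : R} (hw : w ^ 5 = 1) : Covering (twist w a) := by
  constructor <;> simp only [Lyness.twist, Matrix.cons_val]
  · linear_combination h.e0 + (a 1 * a 4 - a 2 * a 3) * hw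
  · linear_combination w ^ 4 * h.e1
  · linear_combination w ^ 3 * h.e2 + w ^ 3 * a 4 ^ 2 * hw
  · linear_combination w ^ 2 * h.e3 - w ^ 2 * a 3 * a 4 * hw
  · linear_combination w * h.e4 + w * (a 3 ^ 2 - a 2 * a 4) * hw

theorem tri_sq (h : Covering a) {f : R} (hf : f ^ 2 - f - 1 = 0) :
    tri f a ^ 2 = (2 * f - 1) * (flex a * dbl f a) := by
  have ⟨_, _, _, _, _⟩ := h
  simp only [flex, tri, dbl]
  grind

theorem tri_mul_tri (h : Covering a) {f : R} (hf : f ^ 2 - f - 1 = 0) :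
    tri f a * tri (1 - f) a = 5 * (a 0 * flex a) := by
  have ⟨_, _, _, _, _⟩ := h
  simp only [flex, tri]
  grind

theorem dbl_mul_dbl (h : Covering a) {f : R} (hf : f ^ 2 - f - 1 = 0) :
    dbl f a * dbl (1 - f) a = -5 * a 0 ^ 2 := by
  have ⟨_, _, _, _, _⟩ := h
  simp only [dbl]
  grind

section RootOfUnity

variable {z : R} (hz : 1 + z + z ^ 2 + z ^ 3 + z ^ 4 = 0)
include hz

theorem flex_mul_flex_twist_mul_flex_twist (h : Covering a) :
    25 * (flex a * flex (Lyness.twist (z ^ 2) a) * flex (Lyness.twist (z ^ 3) a)) =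
      (2 - (z ^ 2 + z ^ 3)) * (tri (-(z ^ 2 + z ^ 3)) a * dbl (-(z ^ 2 + z ^ 3)) a ^ 2) := by
  have ⟨_, _, _, _, _⟩ := h
  simp only [flex, tri, dbl, Lyness.twist, Matrix.cons_val]
  grind

theorem mul_tri_pow_five (h : Covering a) :
    (2 - (z ^ 2 + z ^ 3)) * tri (-(z ^ 2 + z ^ 3)) a ^ 5 =
      125 * (flex a ^ 3 * flex (Lyness.twist (z ^ 2) a) * flex (Lyness.twist (z ^ 3) a)) := by
  have hf : (-(z ^ 2 + z ^ 3)) ^ 2 - -(z ^ 2 + z ^ 3) - 1 = 0 := by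
    linear_combination (z ^ 2 + z - 1) * hz
  have h1 := h.tri_sq hf
  have h2 := h.flex_mul_flex_twist_mul_flex_twist hz
  rw [sub_eq_add_neg] at h2 ⊢
  generalize -(z ^ 2 + z ^ 3) = f at *
  linear_combination
    (2 + f) * tri f a * (tri f a ^ 2 + (2 * f - 1) * (flex a * dbl f a)) * h1 -
      5 * flex a ^ 2 * h2 + 4 * (2 + f) * tri f a * flex a ^ 2 * dbl f a ^ 2 * hf

theorem tri_twist_mul_dbl_twist (h : Covering a) :
    tri (1 + (z ^ 2 + z ^ 3)) (Lyness.twist z a) *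
        dbl (-(z ^ 2 + z ^ 3)) (Lyness.twist (z ^ 4) a) =
      (2 * -(z ^ 2 + z ^ 3) - 1) *
        (flex (Lyness.twist z a) * tri (-(z ^ 2 + z ^ 3)) (Lyness.twist (z ^ 2) a)) := by
  have ⟨_, _, _, _, _⟩ := h
  simp only [flex, tri, dbl, Lyness.twist, Matrix.cons_val]
  grind

end RootOfUnity

theorem eq_of_flex_eq_zero [IsDomain R] (h : Covering a) {f : R} (hf : f ^ 2 - f - 1 = 0)
    (h5 : (5 : R) ≠ 0) (hH : flex a = 0) : a 0 = 0 ∧ a 1 = a 2 := by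
  have tri_eq_zero {g : R} (hg : g ^ 2 - g - 1 = 0) : tri g a = 0 :=
    pow_eq_zero_iff two_ne_zero |>.1 <| by rw [h.tri_sq hg, hH, zero_mul, mul_zero]
  have hL : tri f a = 0 := tri_eq_zero hf
  have hL' : tri (1 - f) a = 0 := tri_eq_zero (by linear_combination hf)
  have hs : 2 * f - 1 ≠ 0 := fun hs ↦ h5 (by linear_combination (2 * f - 1) * hs - 4 * hf)
  simp only [tri] at hL hL'
  have h1 : 4 * a 0 + 2 * (a 1 - a 4) + (a 2 - a 3) = 0 :=
    (mul_eq_zero.1 (by linear_combination hL - hL' : (2 * f - 1) * _ = 0)).resolve_left hs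
  have h4 : a 4 = a 1 - 2 * a 0 := by linear_combination hL - (f + 1) * h1
  have h3 : a 3 = a 2 + 8 * a 0 := by linear_combination (2 * f + 1) * h1 - 2 * hL
  have ⟨e0, e1, e2, e3, _⟩ := h
  rw [h3, h4] at e0 e1 e2 e3
  have h0 : a 0 = 0 := by
    have hmul : a 0 * (a 2 - a 1 + 5 * a 0) = 0 := by
      linear_combination e0 + e1 - 3 * e2 + 2 * e3
    refine (mul_eq_zero.1 hmul).elim id fun h12 ↦ pow_eq_zero_iff two_ne_zero |>.1 ?_
    rw [show a 1 = a 2 + 5 * a 0 by linear_combination -h12] at e2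
    linear_combination e2
  refine ⟨h0, sub_eq_zero.1 (pow_eq_zero_iff two_ne_zero |>.1 ?_)⟩
  rw [h0] at e1 e3
  linear_combination e1 + e3

theorem flex_ne_zero [IsDomain R] (h : Covering a) {f : R} (hf : f ^ 2 - f - 1 = 0)
    (h5 : (5 : R) ≠ 0) (h0 : a 0 ≠ 0) : flex a ≠ 0 :=
  fun hH ↦ h0 (h.eq_of_flex_eq_zero hf h5 hH).1

end Covering

end Covering

section FifthCyclotomicRing

open NumberField IsCMField

section Units

variable {K : Type*} [Field K] [NumberField K] [IsCMField K]

theorem isOfFinOrder_complexConj_div (u : (𝓞 K)ˣ) :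
    IsOfFinOrder (complexConj K u / (u : K)) := by
  have h := (unitsMulComplexConjInv K u)⁻¹.2
  rw [Subgroup.coe_inv, unitsMulComplexConjInv_apply, mul_inv_rev, inv_inv] at h
  simpa [div_eq_mul_inv] using
    MonoidHom.isOfFinOrder (algebraMap (𝓞 K) K : 𝓞 K →* K) (Units.isOfFinOrder_val.2 h)

theorem exists_complexConj_sq_eq_pow_mul_sq {n : ℕ} [NeZero n] [IsCyclotomicExtension {n} ℚ K]
    (hn : Odd n) {ζ : K} (hζ : IsPrimitiveRoot ζ n) (u : (𝓞 K)ˣ) :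
    ∃ r : ℕ, complexConj K u ^ 2 = ζ ^ r * (u : K) ^ 2 := by
  obtain ⟨r, -, hr⟩ :=
    hζ.exists_pow_or_neg_mul_pow_of_isOfFinOrder hn (isOfFinOrder_complexConj_div u)
  refine ⟨r * 2, ?_⟩
  rw [← div_eq_iff (by simp), ← div_pow, pow_mul]
  exact sq_eq_sq_iff_eq_or_eq_neg.2 hr

theorem complexConj_eq_inv_of_pow_eq_one {n : ℕ} (hn : n ≠ 0) {x : K} (hx : x ^ n = 1) :
    complexConj K x = x⁻¹ := by
  obtain ⟨φ⟩ : Nonempty (K →+* ℂ) := inferInstance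
  apply φ.injective
  rw [complexEmbedding_complexConj, map_inv₀, Complex.inv_eq_conj]
  exact Complex.norm_eq_one_of_pow_eq_one (by rw [← map_pow, hx, map_one]) hn

theorem map_map_eq_complexConj [IsCyclotomicExtension {5} ℚ K] {ζ : K}
    (hζ : IsPrimitiveRoot ζ 5) {t : K ≃ₐ[ℚ] K} (ht : t ζ = ζ ^ 2) (x : K) :
    t (t x) = complexConj K x := by
  have hgen : t (t ζ) = complexConj K ζ := by
    rw [complexConj_eq_inv_of_pow_eq_one (by norm_num) hζ.pow_eq_one, ht, map_pow, ht, ← pow_mul]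
    exact eq_inv_of_mul_eq_one_left (by rw [← pow_succ, hζ.pow_eq_one])
  have h := PowerBasis.algHom_ext (hζ.powerBasis ℚ) (f := (t.trans t).toAlgHom)
    (g := ((complexConj K).restrictScalars ℚ).toAlgHom) (by simpa using hgen)
  exact DFunLike.congr_fun h x

end Units

/-- The properties of the ring `ℤ[z]` generated by a primitive fifth root of unity `z`, and of its
automorphism `s : z ↦ z ^ 2`, that the descent uses. As `s ∘ s` is complex conjugation, the last
one says that a unit and its conjugate differ by a root of unity. -/
structure CyclotomicFive {R : Type*} [CommRing R] (z : R) (s : R ≃+* R) : Prop where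
  sum : 1 + z + z ^ 2 + z ^ 3 + z ^ 4 = 0
  map : s z = z ^ 2
  repr : ∀ x : R, ∃ c : Fin 4 → ℤ, x = c 0 + c 1 * z + c 2 * z ^ 2 + c 3 * z ^ 3
  indep : ∀ c : Fin 4 → ℤ, (c 0 + c 1 * z + c 2 * z ^ 2 + c 3 * z ^ 3 : R) = 0 → c = 0
  unit : ∀ x : R, IsUnit x → ∃ j : ℕ, s (s x) ^ 2 = z ^ j * x ^ 2

theorem exists_basis_fin_four {K : Type*} [Field K] [NumberField K]
    [IsCyclotomicExtension {5} ℚ K] {ζ : K} (hζ : IsPrimitiveRoot ζ 5) :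
    ∃ b : Module.Basis (Fin 4) ℤ (𝓞 K), ∀ i, b i = hζ.toInteger ^ (i : ℕ) := by
  have hdim : hζ.integralPowerBasis.dim = 4 := by
    rw [IsPrimitiveRoot.integralPowerBasis_dim]
    decide
  exact ⟨hζ.integralPowerBasis.basis.reindex (finCongr hdim), fun i ↦ by simp⟩

theorem exists_cyclotomicFive_ringOfIntegers (K : Type*) [Field K] [NumberField K]
    [IsCyclotomicExtension {5} ℚ K] : ∃ (z : 𝓞 K) (s : 𝓞 K ≃+* 𝓞 K), CyclotomicFive z s := by
  have : IsCMField K := IsCyclotomicExtension.Rat.isCMField K (S := {5}) ⟨5, rfl, by norm_num⟩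
  have hζ := IsCyclotomicExtension.zeta_spec 5 ℚ K
  have hζ2 := hζ.pow_of_coprime 2 (by norm_num)
  have hirr := Polynomial.cyclotomic.irreducible_rat (n := 5) (by norm_num)
  have ht := IsCyclotomicExtension.fromZetaAut_spec hζ2 hirr
  obtain ⟨b, hb⟩ := exists_basis_fin_four hζ
  refine ⟨hζ.toInteger, RingOfIntegers.mapRingEquiv
    (IsCyclotomicExtension.fromZetaAut hζ2 hirr).toRingEquiv, ?_, ?_, ?_, ?_, ?_⟩
  · simpa [Finset.sum_range_succ] using
      hζ.toInteger_isPrimitiveRoot.geom_sum_eq_zero (by norm_num)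
  · ext
    exact ht
  · intro x
    refine ⟨b.repr x, ?_⟩
    simpa [Fin.sum_univ_four, hb, zsmul_eq_mul] using (b.sum_repr x).symm
  · intro c hc
    exact funext (Fintype.linearIndependent_iff.1 b.linearIndependent c
      (by simpa [Fin.sum_univ_four, hb, zsmul_eq_mul] using hc))
  · rintro _ ⟨u, rfl⟩
    obtain ⟨r, hr⟩ := exists_complexConj_sq_eq_pow_mul_sq (by decide) hζ u
    refine ⟨r, RingOfIntegers.ext ?_⟩
    rw [← map_map_eq_complexConj hζ ht] at hr
    exact hr

theorem exists_cyclotomicFive : ∃ (R : Type) (_ : CommRing R) (_ : IsDomain R)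
    (_ : IsPrincipalIdealRing R) (z : R) (s : R ≃+* R), CyclotomicFive z s :=
  have : IsCyclotomicExtension {5} ℚ (CyclotomicField 5 ℚ) :=
    CyclotomicField.isCyclotomicExtension 5 ℚ
  ⟨𝓞 (CyclotomicField 5 ℚ), inferInstance, inferInstance,
    IsCyclotomicExtension.Rat.five_pid _, exists_cyclotomicFive_ringOfIntegers _⟩

namespace CyclotomicFive

variable {R : Type*} [CommRing R] {z : R} {s : R ≃+* R}

theorem pow_five (h : CyclotomicFive z s) : z ^ 5 = 1 := by
  linear_combination (z - 1) * h.sum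

theorem golden (h : CyclotomicFive z s) : (-(z ^ 2 + z ^ 3)) ^ 2 - -(z ^ 2 + z ^ 3) - 1 = 0 := by
  linear_combination (z ^ 2 + z - 1) * h.sum

theorem map_golden (h : CyclotomicFive z s) : s (-(z ^ 2 + z ^ 3)) = 1 - -(z ^ 2 + z ^ 3) := by
  simp only [map_neg, map_add, map_pow, h.map]
  linear_combination (-z ^ 2 + z - 1) * h.sum

theorem map_map_map_map (h : CyclotomicFive z s) (x : R) : s (s (s (s x))) = x := by
  obtain ⟨c, rfl⟩ := h.repr x
  have hz : s (s (s (s z))) = z := by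
    simp only [map_pow, h.map]
    linear_combination (z ^ 11 + z ^ 6 + z) * h.pow_five
  simp only [map_add, map_mul, map_pow, map_intCast, hz]

theorem dvd_of_intCast_dvd (h : CyclotomicFive z s) {m n : ℤ} (hmn : (m : R) ∣ n) : m ∣ n := by
  obtain ⟨x, hx⟩ := hmn
  obtain ⟨c, rfl⟩ := h.repr x
  have h0 := congrFun (h.indep ![n - m * c 0, -(m * c 1), -(m * c 2), -(m * c 3)] (by
    simp only [Matrix.cons_val]
    push_cast
    rw [hx]
    ring)) 0
  exact ⟨c 0, sub_eq_zero.1 h0⟩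

theorem charZero (h : CyclotomicFive z s) : CharZero R :=
  charZero_of_inj_zero fun n hn ↦ by
    have h0 := h.dvd_of_intCast_dvd (m := 0) (n := n) (by simp [hn])
    exact_mod_cast zero_dvd_iff.1 h0

theorem exists_intCast_of_map_eq (h : CyclotomicFive z s) {x : R} (hx : s x = x) :
    ∃ n : ℤ, x = n := by
  obtain ⟨c, rfl⟩ := h.repr x
  simp only [map_add, map_mul, map_pow, h.map, map_intCast] at hx
  have h0 := h.indep ![-c 2, c 3 - c 2 - c 1, c 1 - c 2 - c 2, -c 2 - c 3] (by
    simp only [Matrix.cons_val]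
    push_cast
    linear_combination hx - (c 2 + c 3 * z * (z - 1)) * h.sum)
  have h02 : -c 2 = 0 := congrFun h0 0
  have h12 : c 3 - c 2 - c 1 = 0 := congrFun h0 1
  have h23 : -c 2 - c 3 = 0 := congrFun h0 3
  have e1 : c 1 = 0 := by linarith
  have e2 : c 2 = 0 := by linarith
  have e3 : c 3 = 0 := by linarith
  exact ⟨c 0, by simp [e1, e2, e3]⟩

theorem isPrimitiveRoot (h : CyclotomicFive z s) : IsPrimitiveRoot z 5 := by
  have := h.charZero
  have hne : z ≠ 1 := by
    rintro rfl
    exact (by norm_num : (1 + 1 + 1 ^ 2 + 1 ^ 3 + 1 ^ 4 : R) ≠ 0) h.sum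
  have : Fact (Nat.Prime 5) := ⟨by norm_num⟩
  exact IsPrimitiveRoot.iff_orderOf.2 (orderOf_eq_prime h.pow_five hne)

theorem exists_eq_mul_of_pow_eq [IsDomain R] (h : CyclotomicFive z s) {x y : R}
    (hxy : x ^ 5 = y ^ 5) : ∃ k : ℕ, x = z ^ k * y := by
  have hx := (Polynomial.mem_nthRoots (by norm_num)).2 hxy
  rw [h.isPrimitiveRoot.nthRoots_eq rfl] at hx
  obtain ⟨k, -, hk⟩ := Multiset.mem_map.1 hx
  exact ⟨k, hk.symm⟩

theorem map_pow_thirteen_pow_four {S : Type*} [CommRing S] [CharP S 13] (h : CyclotomicFive z s)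
    (g : R →+* S) (x : R) : g x ^ 13 ^ 4 = g x := by
  obtain ⟨c, rfl⟩ := h.repr x
  have : ExpChar S 13 := .prime (by norm_num)
  have hz : g z ^ 13 ^ 4 = g z := by
    rw [← map_pow, pow_eq_pow_mod _ h.pow_five]
    norm_num
  rw [← iterateFrobenius_def]
  simp only [map_add, map_mul, map_pow, map_intCast, iterateFrobenius_def, hz]

end CyclotomicFive

end FifthCyclotomicRing

section FiveAdic

theorem Covering.eq_or_eq_of_zmod_five {b : Fin 5 → ZMod 5} (h : Covering b) :
    (b 0 = 0 ∧ b 3 - b 2 = 0 ∧ b 1 - b 2 = 0) ∨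
      (b 2 - b 1 - 3 * b 0 = 0 ∧ b 3 - b 1 - 4 * b 0 = 0 ∧ b 4 - b 1 - 2 * b 0 = 0) := by
  have key : ∀ b0 b1 b2 b3 b4 : ZMod 5, b1 * b4 - b2 * b3 - 13 * b0 ^ 2 = 0 →
      b2 ^ 2 - b1 * b3 + 13 * b0 * b4 = 0 → b4 ^ 2 - b1 * b2 - b0 * b3 = 0 →
      b1 ^ 2 - b3 * b4 + b0 * b2 = 0 → b3 ^ 2 - b2 * b4 - 13 * b0 * b1 = 0 →
      (b0 = 0 ∧ b3 - b2 = 0 ∧ b1 - b2 = 0) ∨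
        (b2 - b1 - 3 * b0 = 0 ∧ b3 - b1 - 4 * b0 = 0 ∧ b4 - b1 - 2 * b0 = 0) := by
    decide +kernel
  exact key _ _ _ _ _ h.e0 h.e1 h.e2 h.e3 h.e4

theorem Covering.five_dvd {a : Fin 5 → ℤ} (h : Covering a) :
    5 ∣ a 0 ∧ 5 ∣ a 3 - a 2 ∧ 5 ∣ a 1 - a 2 := by
  have hmod := (h.map (Int.castRingHom (ZMod 5))).eq_or_eq_of_zmod_five
  simp only [Function.comp_apply, eq_intCast] at hmod
  norm_cast at hmod
  simp only [ZMod.intCast_zmod_eq_zero_iff_dvd, Nat.cast_ofNat] at hmod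
  obtain hmod | ⟨⟨b2, h2⟩, ⟨b3, h3⟩, ⟨b4, h4⟩⟩ := hmod
  · exact hmod
  suffices h0 : 5 ∣ a 0 by omega
  have ⟨e0, e1, _, _, e4⟩ := h
  rw [show a 2 = a 1 + 3 * a 0 + 5 * b2 by linarith, show a 3 = a 1 + 4 * a 0 + 5 * b3 by linarith,
    show a 4 = a 1 + 2 * a 0 + 5 * b4 by linarith] at e0 e1 e4
  have hsq : 4 * a 0 ^ 2 =
      5 * -(a 0 * b3 + 2 * (a 0 * b4) - b2 * b3 + b2 ^ 2 + b3 ^ 2 - b2 * b4) := by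
    linarith
  refine Int.Prime.dvd_pow' (p := 5) (k := 2) (by norm_num) ?_
  omega

theorem Covering.isCoprime_apply_two_five {a : Fin 5 → ℤ} (h : Covering a)
    (hc : IsCoprime (a 1) (a 2)) : IsCoprime (a 2) 5 := by
  refine ((by norm_num : Prime (5 : ℤ)).coprime_iff_not_dvd.2 fun h2 ↦ ?_).symm
  have h1 : 5 ∣ a 1 := (dvd_iff_dvd_of_dvd_sub h.five_dvd.2.2).2 h2
  exact (by norm_num : Prime (5 : ℤ)).not_isUnit (hc.isUnit_of_dvd' h1 h2)

theorem exists_flex_twist_eq_mul {R : Type*} [CommRing R] {z : R}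
    (hz : 1 + z + z ^ 2 + z ^ 3 + z ^ 4 = 0) {a : Fin 5 → R} (h0 : 5 ∣ a 0) (h3 : 5 ∣ a 3 - a 2)
    (h2 : IsCoprime (a 2) 5) :
    ∃ b, flex (twist z a) = (z ^ 2 - z ^ 3) * b ∧ IsCoprime b 5 := by
  obtain ⟨a0, h0⟩ := h0
  obtain ⟨c, hc⟩ := h3
  obtain ⟨k, hk⟩ : ∃ k, k = z ^ 3 * (4 + 3 * z + 2 * z ^ 2 + z ^ 3) := ⟨_, rfl⟩
  have hk5 : (z ^ 2 - z ^ 3) * k = 5 := by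
    rw [hk]
    linear_combination (5 * (z - 1) - z ^ 5) * hz
  have hk2 : k ^ 2 = 5 * (z ^ 2 + z ^ 3 - 2) := by
    rw [hk]
    linear_combination (10 - 10 * z - 5 * z ^ 2 + 5 * z ^ 4 + 10 * z ^ 5 + 6 * z ^ 6 +
      3 * z ^ 7 + z ^ 8) * hz
  refine ⟨3 * a 2 + k * (14 * a0 + z * a 1 - z ^ 4 * a 4 - 3 * z ^ 3 * c), ?_, ?_⟩
  · simp only [flex, twist, Matrix.cons_val, h0]
    linear_combination (14 * a0 + z * a 1 - z ^ 4 * a 4 - 3 * z ^ 3 * c) * -hk5 - 3 * z ^ 3 * hc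
  · have h32 : IsCoprime (3 * a 2) 5 := IsCoprime.mul_left ⟨2, -1, by norm_num⟩ h2
    have h3k : IsCoprime (3 * a 2) k :=
      h32.of_isCoprime_of_dvd_right ⟨_, hk5.symm.trans (mul_comm _ _)⟩
    have hcop := h3k.add_mul_left_left (14 * a0 + z * a 1 - z ^ 4 * a 4 - 3 * z ^ 3 * c)
    exact (hcop.pow_right (n := 2)).of_isCoprime_of_dvd_right ⟨_, hk2⟩

end FiveAdic

section Coprimality

variable {R : Type*} [CommRing R] {a : Fin 5 → R}

theorem Covering.eq_of_flex_twist_eq_zero [IsDomain R] (h : Covering a) {f : R}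
    (hf : f ^ 2 - f - 1 = 0) (h5 : (5 : R) ≠ 0) {w : R} (hw : w ^ 5 = 1)
    (hH : flex (Lyness.twist w a) = 0) : a 1 = w * a 2 := by
  have hww : w * a 1 = w ^ 2 * a 2 := ((h.twist hw).eq_of_flex_eq_zero hf h5 hH).2
  linear_combination w ^ 4 * hww + (w * a 2 - a 1) * hw

theorem Covering.dvd_of_dvd_flex_twist (h : Covering a) {f : R} (hf : f ^ 2 - f - 1 = 0) {p : R}
    (hp : Prime p) (hp5 : ¬p ∣ 5) {w : R} (hw : w ^ 5 = 1) (hd : p ∣ flex (Lyness.twist w a)) :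
    p ∣ a 1 - w * a 2 := by
  have : (Ideal.span {p}).IsPrime := (Ideal.span_singleton_prime hp.ne_zero).2 hp
  let g := Ideal.Quotient.mk (Ideal.span {p})
  have hg (x : R) : g x = 0 ↔ p ∣ x := by
    rw [Ideal.Quotient.eq_zero_iff_mem, Ideal.mem_span_singleton]
  rw [← hg, map_sub, map_mul, sub_eq_zero]
  refine (h.map g).eq_of_flex_twist_eq_zero (f := g f) (by simpa using congrArg g hf) ?_
    (by rw [← map_pow, hw, map_one]) ?_
  · rwa [← map_ofNat g 5, ne_eq, hg]
  · rwa [← map_twist, ← map_flex, hg]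

theorem Covering.dvd_sub_of_dvd_flex_twist (h : Covering a) (hc : IsCoprime (a 1) (a 2)) {f : R}
    (hf : f ^ 2 - f - 1 = 0) {p : R} (hp : Prime p) (hp5 : ¬p ∣ 5) {v w : R} (hv : v ^ 5 = 1)
    (hw : w ^ 5 = 1) (hdv : p ∣ flex (Lyness.twist v a)) (hdw : p ∣ flex (Lyness.twist w a)) :
    p ∣ v - w := by
  have h1 := h.dvd_of_dvd_flex_twist hf hp hp5 hv hdv
  have h2 : p ∣ (v - w) * a 2 := by
    convert (h.dvd_of_dvd_flex_twist hf hp hp5 hw hdw).sub h1 using 1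
    ring
  refine (hp.dvd_or_dvd h2).resolve_right fun h2 ↦ ?_
  exact hp.not_isUnit (hc.isUnit_of_dvd' ((dvd_iff_dvd_of_dvd_sub h1).2 (h2.mul_left v)) h2)

theorem sub_dvd_five_of_pow_five_eq_one [IsDomain R] {v w : R} (hv : v ^ 5 = 1) (hw : w ^ 5 = 1)
    (hvw : v ≠ w) : v - w ∣ 5 := by
  have hsum : v ^ 4 + v ^ 3 * w + v ^ 2 * w ^ 2 + v * w ^ 3 + w ^ 4 = 0 :=
    mul_left_cancel₀ (sub_ne_zero.2 hvw) (by linear_combination hv - hw)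
  exact ⟨-w * (v ^ 3 + 2 * v ^ 2 * w + 3 * v * w ^ 2 + 4 * w ^ 3), by
    linear_combination w * hsum - 5 * hw⟩

theorem Covering.isCoprime_of_dvd_flex_twist [IsDomain R] [IsPrincipalIdealRing R]
    (h : Covering a) (hc : IsCoprime (a 1) (a 2)) {f : R} (hf : f ^ 2 - f - 1 = 0)
    {v w : R} (hv : v ^ 5 = 1) (hw : w ^ 5 = 1) (hvw : v ≠ w) {b c : R} (hb0 : b ≠ 0)
    (hb5 : IsCoprime b 5) (hb : b ∣ flex (Lyness.twist v a))
    (hcw : c ∣ 5 * flex (Lyness.twist w a)) : IsCoprime b c := by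
  refine isCoprime_of_prime_dvd (fun h0 ↦ hb0 h0.1) fun p hp hpb hpc ↦ ?_
  have hp5 : ¬p ∣ 5 := fun hp5 ↦ hp.not_isUnit (hb5.isUnit_of_dvd' hpb hp5)
  exact hp5 <| (h.dvd_sub_of_dvd_flex_twist hc hf hp hp5 hv hw (hpb.trans hb)
    ((hp.dvd_or_dvd (hpc.trans hcw)).resolve_left hp5)).trans
    (sub_dvd_five_of_pow_five_eq_one hv hw hvw)

end Coprimality

section FifthPowers

section Thirteen

theorem CyclotomicFive.exists_ringHom_charP.{u} {R : Type u} [CommRing R] {z : R} {s : R ≃+* R}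
    (hz : CyclotomicFive z s) (p : ℕ) [Fact p.Prime] :
    ∃ (S : Type u) (_ : Field S) (_ : CharP S p), Nonempty (R →+* S) := by
  have hp : ¬IsUnit (p : R) := fun h ↦ by
    have h1 := hz.dvd_of_intCast_dvd (m := p) (n := 1) (by simpa using h.dvd)
    exact (Nat.prime_iff_prime_int.1 Fact.out).not_isUnit (isUnit_of_dvd_one h1)
  obtain ⟨M, hM, hpM⟩ := exists_max_ideal_of_mem_nonunits hp
  let := Ideal.Quotient.field M
  have hp0 : (p : R ⧸ M) = 0 := by
    rw [← map_natCast (Ideal.Quotient.mk M), Ideal.Quotient.eq_zero_iff_mem]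
    exact hpM
  exact ⟨R ⧸ M, inferInstance, (CharP.charP_iff_prime_eq_zero Fact.out).2 hp0,
    ⟨Ideal.Quotient.mk M⟩⟩

variable {S : Type*} [CommRing S] {b : Fin 5 → S}

theorem Covering.ne_zero_of_thirteen_eq_zero [IsDomain S] (h : Covering b) (h13 : (13 : S) = 0)
    (hc : IsCoprime (b 1) (b 2)) : b 1 ≠ 0 ∧ b 2 ≠ 0 := by
  have ⟨_, e1, _, e3, _⟩ := h
  have not_both (h1 : b 1 = 0) (h2 : b 2 = 0) : False :=
    not_isUnit_zero (hc.isUnit_of_dvd' h1.symm.dvd h2.symm.dvd)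
  refine ⟨fun h1 ↦ not_both h1 ?_, fun h2 ↦ not_both ?_ h2⟩
  · rw [h1, h13] at e1
    exact pow_eq_zero_iff two_ne_zero |>.1 (by linear_combination e1)
  · rw [h2, h13] at e1
    rw [h2] at e3
    have h3 : b 1 * b 3 = 0 := by linear_combination -e1
    refine (mul_eq_zero.1 h3).elim id fun h3 ↦ pow_eq_zero_iff two_ne_zero |>.1 ?_
    rw [h3] at e3
    linear_combination e3

theorem Covering.pow_five_eq_of_thirteen_eq_zero (h : Covering b) (h13 : (13 : S) = 0) {w : S}
    (hw : w ^ 5 = 1) :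
    (b 2 - w ^ 4 * b 1) ^ 5 = b 1 ^ 3 * b 2 * flex (Lyness.twist w b) := by
  have ⟨_, _, _, _, _⟩ := h
  simp only [flex, Lyness.twist, Matrix.cons_val]
  grind

theorem intCast_pow_thirteen [CharP S 13] (n : ℤ) : (n : S) ^ 13 = n :=
  have : ExpChar S 13 := .prime (by norm_num)
  map_intCast (frobenius S 13) n

theorem five_ne_zero_of_charP_thirteen [CharP S 13] : (5 : S) ≠ 0 := by
  intro h
  exact absurd ((CharP.cast_eq_zero_iff S 13 5).1 (by exact_mod_cast h)) (by norm_num)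

theorem sq_sub_cube_pow [IsDomain S] [CharP S 13] {z : S} (hz : 1 + z + z ^ 2 + z ^ 3 + z ^ 4 = 0) :
    (z ^ 2 - z ^ 3) ^ 336 = 1 := by
  have : ExpChar S 13 := .prime (by norm_num)
  have hz5 : z ^ 5 = 1 := by linear_combination (z - 1) * hz
  have hsq : (z ^ 2 - z ^ 3) ^ 2 = z + z ^ 4 - 2 := by linear_combination (z - 2) * hz5
  have hne : z + z ^ 4 - 2 ≠ 0 := fun h0 ↦ five_ne_zero_of_charP_thirteen (S := S) <| by
    linear_combination hz + (z ^ 2 + z ^ 3 - 2) * h0 - (z + z ^ 2) * hz5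
  have hfrob : (z + z ^ 4 - 2) ^ 13 ^ 2 = z + z ^ 4 - 2 := by
    rw [← iterateFrobenius_def]
    simp only [map_add, map_sub, map_pow, map_ofNat, iterateFrobenius_def]
    rw [pow_eq_pow_mod (13 ^ 2) hz5]
    change z ^ 4 + (z ^ 4) ^ 4 - 2 = z + z ^ 4 - 2
    linear_combination (z ^ 11 + z ^ 6 + z) * hz5
  rw [show 336 = 2 * 168 from rfl, pow_mul, hsq]
  exact mul_right_cancel₀ hne (by rw [one_mul, ← pow_succ]; exact hfrob)

theorem eq_one_of_intCast_eq_mul [IsDomain S] [CharP S 13] {w : S} (hw : w ^ 5 = 1) {x y : ℤ}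
    (hx : (x : S) ≠ 0) (h : (y : S) = w * x) : w = 1 := by
  have pow_twentyfive (n : ℤ) : (n : S) ^ 25 = n := by
    rw [pow_add _ 12 13, intCast_pow_thirteen, ← pow_succ, intCast_pow_thirteen]
  have hxy : (y : S) = x := by
    rw [← pow_twentyfive y, h, mul_pow, pow_twentyfive, pow_mul w 5 5, hw, one_pow, one_mul]
  exact mul_right_cancel₀ hx (by rw [one_mul, ← h, hxy])

theorem pow_eq_one_of_pow_thirteen_pow_four_eq [IsDomain S] {x : S} (h : x ^ 13 ^ 4 = x)
    (hx : x ≠ 0) : x ^ 28560 = 1 :=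
  mul_right_cancel₀ hx (by rw [one_mul, ← pow_succ]; exact h)

theorem intCast_pow_twelve_mul [IsDomain S] [CharP S 13] {n : ℤ} (hn : (n : S) ≠ 0)
    (k : ℕ) : (n : S) ^ (12 * k) = 1 := by
  have h : (n : S) ^ 12 = 1 :=
    mul_right_cancel₀ hn (by rw [one_mul, ← pow_succ, intCast_pow_thirteen])
  rw [pow_mul, h, one_pow]

theorem intCast_sub_pow_four_mul_pow [IsDomain S] [CharP S 13] {z : S}
    (hz : 1 + z + z ^ 2 + z ^ 3 + z ^ 4 = 0) {x : ℤ} (hx : (x : S) ≠ 0) (y : ℤ) :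
    (y - z ^ 4 * x : S) ^ 28560 = 1 := by
  have : ExpChar S 13 := .prime (by norm_num)
  have hz5 : z ^ 5 = 1 := by linear_combination (z - 1) * hz
  refine pow_eq_one_of_pow_thirteen_pow_four_eq ?_ fun h0 ↦
    five_ne_zero_of_charP_thirteen (S := S) ?_
  · rw [← iterateFrobenius_def]
    simp only [map_sub, map_mul, map_pow, map_intCast, iterateFrobenius_def]
    rw [pow_eq_pow_mod (13 ^ 4) hz5, show 13 ^ 4 % 5 = 1 from rfl, pow_one]
  · have hz4 : z ^ 4 = 1 := eq_one_of_intCast_eq_mul (by rw [pow_right_comm, hz5, one_pow]) hx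
      (sub_eq_zero.1 h0)
    have hz1 : z = 1 := by linear_combination hz5 - z * hz4
    rw [hz1] at hz
    linear_combination hz

theorem pow_eq_one_of_intCast_sub_pow_five_eq [IsDomain S] [CharP S 13] {z : S}
    (hz : 1 + z + z ^ 2 + z ^ 3 + z ^ 4 = 0) {x y : ℤ} (hx : (x : S) ≠ 0) (hy : (y : S) ≠ 0)
    {j : ℕ} {t : S} (ht : t ^ 13 ^ 4 = t)
    (h : (y - z ^ 4 * x) ^ 5 = x ^ 3 * y * ((z ^ 2 - z ^ 3) * (z ^ j * t ^ 5))) : z ^ j = 1 := by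
  have hX := intCast_sub_pow_four_mul_pow hz hx y
  have ht0 : t ≠ 0 := by
    rintro rfl
    have hX0 : (y - z ^ 4 * x : S) ^ 5 = 0 := by rw [h]; ring
    rw [pow_eq_zero_iff (by norm_num)] at hX0
    simp [hX0] at hX
  -- As `5 * 5712 = 13 ^ 4 - 1`, the exponent `5712` kills everything but the power of `z`.
  have hpow := congrArg (· ^ 5712) h
  simp only [mul_pow, ← pow_mul, Nat.reduceMul] at hpow
  rw [hX, pow_eq_one_of_pow_thirteen_pow_four_eq ht ht0, intCast_pow_twelve_mul hx 1428,
    intCast_pow_twelve_mul hy 476, pow_mul _ 336 17, sq_sub_cube_pow hz] at hpow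
  have hj : z ^ (j * 5712) = 1 := by simpa using hpow.symm
  have hz5 : z ^ 5 = 1 := by linear_combination (z - 1) * hz
  calc z ^ j = z ^ (5 * (j * 3427)) * z ^ j := by rw [pow_mul, hz5, one_pow, one_mul]
    _ = (z ^ (j * 5712)) ^ 3 := by rw [← pow_mul, ← pow_add]; congr 1; ring
    _ = 1 := by rw [hj, one_pow]

end Thirteen

section Conjugates

variable {R : Type*} [CommRing R] {z : R} {s : R ≃+* R}

theorem CyclotomicFive.pow_eq_one_of_flex_twist_eq [IsDomain R] (hz : CyclotomicFive z s)
    {a : Fin 5 → ℤ} (h : Covering a) (hc : IsCoprime (a 1) (a 2)) {j : ℕ} {t : R}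
    (ht : flex (twist z (Int.castRingHom R ∘ a)) = (z ^ 2 - z ^ 3) * (z ^ j * t ^ 5)) :
    z ^ j = 1 := by
  have : Fact (Nat.Prime 13) := ⟨by norm_num⟩
  obtain ⟨S, _, _, ⟨g⟩⟩ := hz.exists_ringHom_charP 13
  have h13 : (13 : S) = 0 := CharP.cast_eq_zero S 13
  have hb := h.map (Int.castRingHom S)
  have hsum : 1 + g z + g z ^ 2 + g z ^ 3 + g z ^ 4 = 0 := by simpa using congrArg g hz.sum
  have hz5 : g z ^ 5 = 1 := by rw [← map_pow, hz.pow_five, map_one]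
  obtain ⟨h1, h2⟩ := hb.ne_zero_of_thirteen_eq_zero h13 (hc.map (Int.castRingHom S))
  have hcast : g ∘ Int.castRingHom R ∘ a = Int.castRingHom S ∘ a := by ext; simp
  have hgt : flex (twist (g z) (Int.castRingHom S ∘ a)) =
      (g z ^ 2 - g z ^ 3) * (g z ^ j * g t ^ 5) := by
    rw [← hcast, ← map_twist, ← map_flex, ht]
    simp
  have hgj := pow_eq_one_of_intCast_sub_pow_five_eq hsum h1 h2
    (hz.map_pow_thirteen_pow_four g t) (hgt ▸ hb.pow_five_eq_of_thirteen_eq_zero h13 hz5)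
  by_contra hne
  have hd := sub_dvd_five_of_pow_five_eq_one
    (by rw [pow_right_comm, hz.pow_five, one_pow]) (one_pow 5) hne
  have hd := map_dvd g hd
  rw [map_sub, map_pow, hgj, map_one, sub_self, zero_dvd_iff, map_ofNat] at hd
  exact five_ne_zero_of_charP_thirteen hd

variable {a : Fin 5 → R}

theorem map_flex_twist (ha : s ∘ a = a) (w : R) :
    s (flex (twist w a)) = flex (twist (s w) a) := by
  rw [map_flex, map_twist, ha]

theorem CyclotomicFive.map_tri_twist (hz : CyclotomicFive z s) (ha : s ∘ a = a) (w : R) :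
    s (tri (-(z ^ 2 + z ^ 3)) (twist w a)) = tri (1 - -(z ^ 2 + z ^ 3)) (twist (s w) a) := by
  rw [map_tri, map_twist, hz.map_golden, ha]

theorem CyclotomicFive.map_tri_conj_twist (hz : CyclotomicFive z s) (ha : s ∘ a = a) (w : R) :
    s (tri (1 - -(z ^ 2 + z ^ 3)) (twist w a)) = tri (-(z ^ 2 + z ^ 3)) (twist (s w) a) := by
  rw [map_tri, map_twist, map_sub, map_one, hz.map_golden, ha, sub_sub_cancel]

theorem CyclotomicFive.flex_twist_conj (hz : CyclotomicFive z s) (ha : s ∘ a = a) {b : R}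
    (hb : flex (twist z a) = (z ^ 2 - z ^ 3) * b) :
    flex (twist (z ^ 2) a) = (z ^ 4 - z) * s b ∧
      flex (twist (z ^ 4) a) = (z ^ 3 - z ^ 2) * s (s b) ∧
      flex (twist (z ^ 3) a) = (z - z ^ 4) * s (s (s b)) := by
  have s2 : s (z ^ 2) = z ^ 4 := by rw [map_pow, hz.map, ← pow_mul]
  have s3 : s (z ^ 3) = z := by rw [map_pow, hz.map]; linear_combination z * hz.pow_five
  have s4 : s (z ^ 4) = z ^ 3 := by rw [map_pow, hz.map]; linear_combination z ^ 3 * hz.pow_five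
  have h2 := congrArg s hb
  rw [map_flex_twist ha, hz.map, map_mul, map_sub, s2, s3] at h2
  have h4 := congrArg s h2
  rw [map_flex_twist ha, s2, map_mul, map_sub, s4, hz.map] at h4
  have h3 := congrArg s h4
  rw [map_flex_twist ha, s4, map_mul, map_sub, s3, s2] at h3
  exact ⟨h2, h4, h3⟩

theorem CyclotomicFive.two_sub_ne_zero [IsDomain R] (hz : CyclotomicFive z s) :
    2 - (z ^ 2 + z ^ 3) ≠ 0 := fun h0 ↦ by
  have := hz.charZero
  refine OfNat.ofNat_ne_zero (R := R) 5 ?_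
  linear_combination (3 + (z ^ 2 + z ^ 3)) * h0 + (z ^ 2 + z - 1) * hz.sum

section Norm

variable [IsDomain R] (hz : CyclotomicFive z s) (h : Covering a) (ha : s ∘ a = a) {b : R}
  (hb : flex (twist z a) = (z ^ 2 - z ^ 3) * b)
include hz h ha hb

theorem CyclotomicFive.flex_mul_conj_mul_conj :
    25 * (flex a * s b * s (s (s b))) =
      tri (-(z ^ 2 + z ^ 3)) a * dbl (-(z ^ 2 + z ^ 3)) a ^ 2 := by
  obtain ⟨h2, -, h3⟩ := hz.flex_twist_conj ha hb
  apply mul_left_cancel₀ hz.two_sub_ne_zero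
  rw [← h.flex_mul_flex_twist_mul_flex_twist hz.sum, h2, h3]
  linear_combination (50 - 50 * z - 25 * z ^ 3 + 25 * z ^ 4) * flex a * s b * s (s (s b)) * hz.sum

theorem CyclotomicFive.tri_pow_five :
    tri (-(z ^ 2 + z ^ 3)) a ^ 5 = (5 * flex a) ^ 3 * (s b * s (s (s b))) := by
  obtain ⟨h2, -, h3⟩ := hz.flex_twist_conj ha hb
  apply mul_left_cancel₀ hz.two_sub_ne_zero
  rw [h.mul_tri_pow_five hz.sum, h2, h3]
  linear_combination
    -5 * (50 - 50 * z - 25 * z ^ 3 + 25 * z ^ 4) * flex a ^ 3 * s b * s (s (s b)) * hz.sum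

theorem CyclotomicFive.mul_flex_mul_conj (hH : flex a ≠ 0) :
    b * (5 * flex a * (s b * s (s b) * s (s (s b)))) = a 0 ^ 5 := by
  have := hz.charZero
  have h1 := hz.flex_mul_conj_mul_conj h ha hb
  have h2 := congrArg s h1
  simp only [map_mul, map_pow, map_flex, map_tri, map_dbl, hz.map_golden, ha, map_ofNat,
    hz.map_map_map_map] at h2
  have h3 := h.tri_mul_tri hz.golden
  have h4 := h.dbl_mul_dbl hz.golden
  generalize -(z ^ 2 + z ^ 3) = f at *
  apply mul_left_cancel₀ (mul_ne_zero (by norm_num : (125 : R) ≠ 0) hH)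
  linear_combination 25 * flex a * b * s (s b) * h1 + tri f a * dbl f a ^ 2 * h2 +
    (dbl f a * dbl (1 - f) a) ^ 2 * h3 +
    5 * a 0 * flex a * (dbl f a * dbl (1 - f) a - 5 * a 0 ^ 2) * h4

theorem CyclotomicFive.isCoprime_mul_conj [IsPrincipalIdealRing R] (hc : IsCoprime (a 1) (a 2))
    (hb0 : b ≠ 0) (hb5 : IsCoprime b 5) :
    IsCoprime b (5 * flex a * (s b * s (s b) * s (s (s b)))) := by
  obtain ⟨h2, h4, h3⟩ := hz.flex_twist_conj ha hb
  have hroot := hz.isPrimitiveRoot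
  have key (k : ℕ) (hk : k < 5) (hk1 : k ≠ 1) {c : R} (hcw : c ∣ 5 * flex (twist (z ^ k) a)) :
      IsCoprime b c :=
    h.isCoprime_of_dvd_flex_twist hc hz.golden hz.pow_five
      (by rw [pow_right_comm, hz.pow_five, one_pow])
      (fun hzk ↦ hk1 (hroot.pow_inj hk (by norm_num) (by rw [pow_one, ← hzk])))
      hb0 hb5 (Dvd.intro_left _ hb.symm) hcw
  refine (key 0 (by norm_num) (by norm_num) ?_).mul_right
    (((key 2 (by norm_num) (by norm_num) ?_).mul_right
      (key 4 (by norm_num) (by norm_num) ?_)).mul_right (key 3 (by norm_num) (by norm_num) ?_))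
  · rw [pow_zero, one_twist]
  · exact (Dvd.intro_left _ h2.symm).mul_left _
  · exact (Dvd.intro_left _ h4.symm).mul_left _
  · exact (Dvd.intro_left _ h3.symm).mul_left _

end Norm

namespace CyclotomicFive

theorem exists_intCast_eq_norm (hz : CyclotomicFive z s) (b : R) :
    ∃ n : ℤ, b * s b * s (s b) * s (s (s b)) = n := by
  apply hz.exists_intCast_of_map_eq
  simp only [map_mul, hz.map_map_map_map]
  ring

theorem isCoprime_of_isCoprime_intCast (hz : CyclotomicFive z s) {m n : ℤ}
    (hmn : IsCoprime (m : R) n) : IsCoprime m n := by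
  have hgcd : IsUnit ((Int.gcd m n : ℤ) : R) :=
    hmn.isUnit_of_dvd' (Int.cast_dvd_cast _ _ (Int.gcd_dvd_left m n))
      (Int.cast_dvd_cast _ _ (Int.gcd_dvd_right m n))
  rw [Int.isCoprime_iff_gcd_eq_one]
  have h1 : (Int.gcd m n : ℤ) ∣ 1 := hz.dvd_of_intCast_dvd (by simpa using hgcd.dvd (a := 1))
  exact_mod_cast Int.eq_one_of_dvd_one (by positivity) h1

theorem exists_eq_pow_five_of_mul_norm_eq (hz : CyclotomicFive z s) {k c : ℤ} {b : R}
    (hcop : IsCoprime b (k * (s b * s (s b) * s (s (s b)))))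
    (h : b * (k * (s b * s (s b) * s (s (s b)))) = (c : R) ^ 5) : ∃ m, k = m ^ 5 := by
  obtain ⟨n, hn⟩ := hz.exists_intCast_eq_norm b
  have := hz.charZero
  refine Int.eq_pow_of_mul_eq_pow_odd_left (b := n) (c := c) ?_ (by decide) ?_
  · have h0 : IsCoprime (k : R) b := hcop.symm.of_mul_left_left
    have h1 : IsCoprime (k : R) (s b) := by simpa using h0.map s.toRingHom
    have h2 : IsCoprime (k : R) (s (s b)) := by simpa using h1.map s.toRingHom
    have h3 : IsCoprime (k : R) (s (s (s b))) := by simpa using h2.map s.toRingHom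
    apply hz.isCoprime_of_isCoprime_intCast
    rw [← hn]
    exact ((h0.mul_right h1).mul_right h2).mul_right h3
  · apply Int.cast_injective (α := R)
    push_cast
    rw [← h, ← hn]
    ring

theorem eq_pow_mul_pow_five_of_isUnit (hz : CyclotomicFive z s) {x y : R} (hx : IsUnit x)
    (hxy : y ^ 5 = x * s (s x)) : ∃ (j : ℕ) (t : R), x = z ^ j * t ^ 5 := by
  obtain ⟨j, hj⟩ := hz.unit x hx
  obtain ⟨x', hx'⟩ := hx.exists_right_inv
  refine ⟨j, y ^ 8 * x' ^ 3, ?_⟩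
  have h1 : y ^ 10 = z ^ j * x ^ 4 := by
    linear_combination (y ^ 5 + x * s (s x)) * hxy + x ^ 2 * hj
  calc x = (z ^ 5) ^ j * (x * (x * x') ^ 15) := by rw [hz.pow_five, hx', one_pow, one_pow]; ring
    _ = z ^ j * (z ^ j * x ^ 4) ^ 4 * x' ^ 15 := by ring
    _ = z ^ j * (y ^ 8 * x' ^ 3) ^ 5 := by rw [← h1]; ring

theorem exists_eq_pow_mul_pow_five [IsDomain R] [IsIntegrallyClosed R] (hz : CyclotomicFive z s)
    {b d m y : R} (hb0 : b ≠ 0) (hd : Associated (d ^ 5) b) (hm : m ≠ 0)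
    (h : y ^ 5 = m ^ 5 * (s b * s (s (s b)))) : ∃ (j : ℕ) (t : R), b = z ^ j * t ^ 5 := by
  obtain ⟨u, rfl⟩ := hd
  have hd0 : d ≠ 0 := fun hd0 ↦ hb0 (by simp [hd0])
  have hpow : y ^ 5 = (m * s d * s (s (s d))) ^ 5 * s (u * s (s u)) := by
    rw [h]
    simp only [map_mul, map_pow]
    ring
  obtain ⟨x, hx⟩ := (IsIntegrallyClosed.pow_dvd_pow_iff (n := 5) (by norm_num)).1
    (Dvd.intro _ hpow.symm)
  have hunit : s.symm x ^ 5 = (u : R) * s (s (u : R)) := by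
    rw [← map_pow, s.symm_apply_eq]
    have h0 : (m * s d * s (s (s d))) ^ 5 ≠ 0 := by simp [hm, hd0]
    exact mul_left_cancel₀ h0 (by rw [← hpow, hx, mul_pow _ x])
  obtain ⟨j, t, ht⟩ := hz.eq_pow_mul_pow_five_of_isUnit u.isUnit hunit
  exact ⟨j, d * t, by rw [ht]; ring⟩

end CyclotomicFive

theorem Covering.exists_fifth_powers [IsDomain R] [IsPrincipalIdealRing R]
    (hz : CyclotomicFive z s) {a : Fin 5 → ℤ} (h : Covering a) (hc : IsCoprime (a 1) (a 2))
    (ha0 : a 0 ≠ 0) : ∃ (m : ℤ) (t : R), 5 * flex a = m ^ 5 ∧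
      flex (Lyness.twist z (Int.castRingHom R ∘ a)) = (z ^ 2 - z ^ 3) * t ^ 5 := by
  have := hz.charZero
  obtain ⟨b, hb, hb5⟩ : ∃ b, flex (Lyness.twist z (Int.castRingHom R ∘ a)) =
      (z ^ 2 - z ^ 3) * b ∧ IsCoprime b 5 := by
    obtain ⟨h0, h3, -⟩ := h.five_dvd
    exact exists_flex_twist_eq_mul hz.sum (by simpa using map_dvd (Int.castRingHom R) h0)
      (by simpa using map_dvd (Int.castRingHom R) h3)
      (by simpa using (h.isCoprime_apply_two_five hc).map (Int.castRingHom R))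
  have hA := h.map (Int.castRingHom R)
  have hs : s ∘ Int.castRingHom R ∘ a = Int.castRingHom R ∘ a := by ext; simp
  have hH := hA.flex_ne_zero hz.golden (OfNat.ofNat_ne_zero 5) (by simpa using ha0)
  have hprod := hz.mul_flex_mul_conj hA hs hb hH
  have hb0 : b ≠ 0 := by
    rintro rfl
    exact ha0 (by simpa using hprod.symm)
  have hcop := hz.isCoprime_mul_conj hA hs hb (hc.map (Int.castRingHom R)) hb0 hb5
  have hcast : 5 * flex (Int.castRingHom R ∘ a) = ((5 * flex a : ℤ) : R) := by
    rw [← map_flex]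
    simp
  obtain ⟨m, hm⟩ := hz.exists_eq_pow_five_of_mul_norm_eq (hcast ▸ hcop) (hcast ▸ hprod)
  have hm' : 5 * flex (Int.castRingHom R ∘ a) = (m : R) ^ 5 := by rw [hcast, hm, Int.cast_pow]
  have hm0 : (m : R) ≠ 0 := fun h0 ↦ mul_ne_zero (OfNat.ofNat_ne_zero 5) hH (by rw [hm', h0]; ring)
  obtain ⟨d, hd⟩ := exists_associated_pow_of_mul_eq_pow' hcop hprod
  have htri := hz.tri_pow_five hA hs hb
  rw [hm', pow_right_comm] at htri
  obtain ⟨j, t, rfl⟩ := hz.exists_eq_pow_mul_pow_five hb0 hd (pow_ne_zero 3 hm0) htri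
  exact ⟨m, t, hm, by rw [hb, hz.pow_eq_one_of_flex_twist_eq h hc hb, one_mul]⟩

end Conjugates

end FifthPowers

section DualCovering

variable {R : Type*} [CommRing R]

/-- The affine cone over the elliptic curve of degree five in `ℙ⁴` on which the fifth roots of the
hyperplane sections `flex (twist w a)`, for `w ^ 5 = 1`, of a point `a` of the covering lie. Its
coordinates are weighted like those of `a`, so that `twist` acts on it as well. -/
structure DualCovering (f : R) (g : Fin 5 → R) : Prop where
  e0 : g 0 ^ 2 = f * (g 2 * g 3) + (1 - f) * (g 1 * g 4)
  e1 : g 1 ^ 2 = f * (g 3 * g 4) + (1 - f) ^ 3 * (g 0 * g 2)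
  e2 : g 2 ^ 2 = (1 - f) * (g 1 * g 3) + f ^ 3 * (g 0 * g 4)
  e4 : g 4 ^ 2 = f * (g 1 * g 2) + (1 - f) ^ 3 * (g 0 * g 3)
  e3 : g 3 ^ 2 = (1 - f) * (g 2 * g 4) + f ^ 3 * (g 0 * g 1)

/-- The linear form whose values at the five twists of a point of the dual covering satisfy
`x * x'' = g 0 ^ 2 + g 0 * x'`, the recurrence of the Lyness cycles, up to scaling. -/
def cycleTerm (g : Fin 5 → R) : R := 2 * g 0 + g 1 + g 2 + g 3 + g 4

namespace DualCovering

variable {f z : R} {g : Fin 5 → R}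

theorem twist (h : DualCovering f g) {w : R} (hw : w ^ 5 = 1) :
    DualCovering f (twist w g) := by
  constructor <;> simp only [Lyness.twist, Matrix.cons_val]
  · linear_combination h.e0 - (f * (g 2 * g 3) + (1 - f) * (g 1 * g 4)) * hw
  · linear_combination w ^ 2 * h.e1 - w ^ 2 * f * (g 3 * g 4) * hw
  · linear_combination w ^ 4 * h.e2
  · linear_combination w ^ 8 * h.e4 +
      w ^ 3 * (f * (g 1 * g 2) + (1 - f) ^ 3 * (g 0 * g 3)) * hw
  · linear_combination w ^ 6 * h.e3 + w * f ^ 3 * (g 0 * g 1) * hw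

theorem cycleTerm_mul_cycleTerm (hz : 1 + z + z ^ 2 + z ^ 3 + z ^ 4 = 0)
    (h : DualCovering (-(z ^ 2 + z ^ 3)) g) :
    cycleTerm (Lyness.twist (z ^ 3) g) * cycleTerm (Lyness.twist (z ^ 2) g) =
      g 0 ^ 2 + g 0 * cycleTerm g := by
  simp only [cycleTerm, Lyness.twist, Matrix.cons_val]
  linear_combination (norm := grind) h.e0 + h.e1 + h.e2 + h.e3 + h.e4

end DualCovering

theorem sum_cycleTerm_twist {z : R} (hz : 1 + z + z ^ 2 + z ^ 3 + z ^ 4 = 0) (g : Fin 5 → R) :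
    cycleTerm (twist (z ^ 0) g) + cycleTerm (twist (z ^ 2) g) + cycleTerm (twist (z ^ 4) g) +
      cycleTerm (twist (z ^ 1) g) + cycleTerm (twist (z ^ 3) g) = 10 * g 0 := by
  simp only [cycleTerm, Lyness.twist, Matrix.cons_val]
  grind

end DualCovering

section Descent

variable {R : Type*} [CommRing R] [IsDomain R] {z : R} {s : R ≃+* R}

namespace CyclotomicFive

theorem exists_eq_mul_of_pow_five_eq (hz : CyclotomicFive z s) {x y : R} (h : x ^ 5 = y ^ 5) :
    ∃ c, c ^ 5 = 1 ∧ s c = c ^ 2 ∧ x = c * y := by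
  obtain ⟨k, hk⟩ := hz.exists_eq_mul_of_pow_eq h
  exact ⟨z ^ k, by rw [pow_right_comm, hz.pow_five, one_pow],
    by rw [map_pow, hz.map, pow_right_comm], hk⟩

theorem eq_of_pow_five_eq_of_map_map_eq (hz : CyclotomicFive z s) {x y : R}
    (hx : s (s x) = x) (hy : s (s y) = y) (h : x ^ 5 = y ^ 5) : x = y := by
  obtain ⟨c, hc, hsc, rfl⟩ := hz.exists_eq_mul_of_pow_five_eq h
  rcases eq_or_ne y 0 with rfl | hy0
  · rw [mul_zero]
  have h4 : c ^ 4 = c := by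
    refine mul_right_cancel₀ hy0 ?_
    simpa only [map_mul, map_pow, hsc, hy, ← pow_mul] using hx
  rw [show c = 1 by linear_combination (c ^ 2 + 1) * hc - (c ^ 3 + c + 1) * h4, one_mul]

theorem eq_of_pow_five_eq_of_map_map_sq_mul_map_eq (hz : CyclotomicFive z s) {e x y : R}
    (hx : s (s x) ^ 2 * s x = e * x) (hy : s (s y) ^ 2 * s y = e * y) (h : x ^ 5 = y ^ 5) :
    x = y := by
  obtain ⟨c, hc, hsc, rfl⟩ := hz.exists_eq_mul_of_pow_five_eq h
  rcases eq_or_ne y 0 with rfl | hy0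
  · rw [mul_zero]
  have hy0' : s (s y) ^ 2 * s y ≠ 0 := by simpa using hy0
  simp only [map_mul, map_pow, hsc] at hx
  have hc1 : c = 1 := by
    refine mul_right_cancel₀ hy0' ?_
    linear_combination -hx + c * hy + (c ^ 5 + 1) * (s (s y) ^ 2 * s y) * hc
  rw [hc1, one_mul]

omit [IsDomain R] in
theorem dualCovering_of_map_eq (hz : CyclotomicFive z s) {m g : R} (hsm : s m = m)
    (e0 : m ^ 2 = -(z ^ 2 + z ^ 3) * (s g * s (s (s g))) +
      (1 - -(z ^ 2 + z ^ 3)) * (g * s (s g)))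
    (e1 : g ^ 2 = -(z ^ 2 + z ^ 3) * (s (s (s g)) * s (s g)) +
      (1 - -(z ^ 2 + z ^ 3)) ^ 3 * (m * s g)) :
    DualCovering (-(z ^ 2 + z ^ 3)) ![m, g, s g, s (s (s g)), s (s g)] := by
  have e2 := congrArg s e1
  have e4 := congrArg (fun x ↦ s (s x)) e1
  have e3 := congrArg (fun x ↦ s (s (s x))) e1
  simp only [map_add, map_sub, map_mul, map_pow s g, map_pow, map_one, hz.map_golden, hsm,
    hz.map_map_map_map, sub_sub_cancel] at e2 e4 e3
  constructor <;> simp only [Matrix.cons_val]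
  · linear_combination e0
  · linear_combination e1
  · linear_combination e2
  · linear_combination e4
  · linear_combination e3

section Relations

variable (hz : CyclotomicFive z s) {a : Fin 5 → R} (h : Covering a) (ha : s ∘ a = a)
  {t : R} (ht : flex (twist z a) = (z ^ 2 - z ^ 3) * t ^ 5) (h0 : a 0 ≠ 0)
include hz h ha

include h0 in
theorem map_map_tri_twist_sq_mul :
    s (s (tri (-(z ^ 2 + z ^ 3)) (twist z a))) ^ 2 * s (tri (-(z ^ 2 + z ^ 3)) (twist z a)) =
      5 * flex (twist (z ^ 2) a) * flex (twist (z ^ 4) a) *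
        tri (-(z ^ 2 + z ^ 3)) (twist z a) := by
  have := hz.charZero
  have h5 : (5 : R) ≠ 0 := OfNat.ofNat_ne_zero 5
  have h1 := h.twist hz.pow_five
  have h4 := h.twist (w := z ^ 4) (by rw [pow_right_comm, hz.pow_five, one_pow])
  have hF : flex (twist z a) ≠ 0 := h1.flex_ne_zero hz.golden h5 h0
  have hprod : tri (-(z ^ 2 + z ^ 3)) (twist z a) * tri (1 - -(z ^ 2 + z ^ 3)) (twist z a) =
    5 * (a 0 * flex (twist z a)) := h1.tri_mul_tri hz.golden
  have hprod' := congrArg s hprod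
  have hcross := h.tri_twist_mul_dbl_twist hz.sum
  have hsq := h4.tri_sq hz.golden
  have hs : s (s (tri (-(z ^ 2 + z ^ 3)) (twist z a))) =
      tri (-(z ^ 2 + z ^ 3)) (twist (z ^ 4) a) := by
    rw [hz.map_tri_twist ha, hz.map_tri_conj_twist ha, hz.map, map_pow, hz.map, ← pow_mul]
  simp only [map_mul, map_ofNat, map_flex_twist ha, hz.map_tri_conj_twist ha,
    show s (a 0) = a 0 from congrFun ha 0, hz.map] at hprod'
  rw [hs, hsq]
  have hf := hz.golden
  rw [← sub_neg_eq_add 1] at hcross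
  generalize -(z ^ 2 + z ^ 3) = f at *
  apply mul_left_cancel₀ (mul_ne_zero h5 (mul_ne_zero h0 hF))
  grind

include ht h0

theorem tri_twist_eq : tri (-(z ^ 2 + z ^ 3)) (twist z a) =
    (1 + 2 * (z ^ 2 + z ^ 3)) * (z ^ 2 - z ^ 3) * (t ^ 3 * s (s t) * s (s (s t))) := by
  obtain ⟨h2, h4, h3⟩ := hz.flex_twist_conj ha ht
  simp only [map_pow] at h2 h3 h4
  refine hz.eq_of_pow_five_eq_of_map_map_sq_mul_map_eq
    (hz.map_map_tri_twist_sq_mul h ha h0) ?_ ?_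
  · rw [h2, h4]
    simp only [map_mul, map_add, map_sub, map_pow, map_one, map_ofNat, hz.map, hz.map_map_map_map]
    have := hz.sum
    grind
  · apply mul_left_cancel₀ hz.two_sub_ne_zero
    rw [(h.twist hz.pow_five).mul_tri_pow_five hz.sum, twist_twist, twist_twist, ← pow_succ,
      ← pow_succ, h3, h4, ht]
    have := hz.sum
    grind

variable {m : R} (hm : 5 * flex a = m ^ 5) (hsm : s m = m)
include hm hsm

theorem apply_zero_eq : a 0 = m * (t * s t * s (s t) * s (s (s t))) := by
  have := hz.charZero
  have hH : flex a ≠ 0 := h.flex_ne_zero hz.golden (OfNat.ofNat_ne_zero 5) h0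
  have ha0 : s (a 0) = a 0 := congrFun ha 0
  apply hz.eq_of_pow_five_eq_of_map_map_eq
  · rw [ha0, ha0]
  · simp only [map_mul, hsm, hz.map_map_map_map]
    ring
  · rw [← hz.mul_flex_mul_conj h ha ht hH, hm]
    simp only [map_pow]
    ring

theorem tri_conj_twist_eq : tri (1 - -(z ^ 2 + z ^ 3)) (twist z a) =
    (1 + 2 * (z ^ 2 + z ^ 3)) * (m * (t ^ 3 * s t)) := by
  have := hz.charZero
  have h5 : (5 : R) ≠ 0 := OfNat.ofNat_ne_zero 5
  have h1 := h.twist hz.pow_five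
  have hprod : tri (-(z ^ 2 + z ^ 3)) (twist z a) * tri (1 - -(z ^ 2 + z ^ 3)) (twist z a) =
    5 * (a 0 * flex (twist z a)) := h1.tri_mul_tri hz.golden
  have hne : 5 * (a 0 * flex (twist z a)) ≠ 0 :=
    mul_ne_zero h5 (mul_ne_zero h0 (h1.flex_ne_zero hz.golden h5 h0))
  apply mul_left_cancel₀ (left_ne_zero_of_mul (hprod ▸ hne))
  rw [hprod, hz.tri_twist_eq h ha ht h0, hz.apply_zero_eq h ha ht h0 hm hsm, ht]
  have := hz.sum
  grind

omit h0
theorem tri_eq : tri (-(z ^ 2 + z ^ 3)) a = m ^ 3 * (s t * s (s (s t))) := by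
  apply hz.eq_of_pow_five_eq_of_map_map_eq
  · simp only [map_tri, ha, hz.map_golden, map_sub, map_one, sub_sub_cancel]
  · simp only [map_mul, map_pow, hsm, hz.map_map_map_map]
    ring
  · rw [hz.tri_pow_five h ha ht, hm]
    simp only [map_pow]
    ring

theorem tri_conj_eq : tri (1 - -(z ^ 2 + z ^ 3)) a = m ^ 3 * (t * s (s t)) := by
  have h1 := congrArg s (hz.tri_eq h ha ht hm hsm)
  rw [map_tri, hz.map_golden, ha] at h1
  simp only [map_mul, map_pow, hsm, hz.map_map_map_map] at h1
  rw [h1, mul_comm t]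

include h0

theorem sq_eq : m ^ 2 = (1 + 2 * (z ^ 2 + z ^ 3)) * ((1 + (z ^ 2 + z ^ 3)) ^ 2 * (t * s (s t)) -
    (z ^ 2 + z ^ 3) ^ 2 * (s t * s (s (s t)))) := by
  have := hz.charZero
  have hm0 := left_ne_zero_of_mul (hz.apply_zero_eq h ha ht h0 hm hsm ▸ h0)
  have e0 := flex_eq_tri hz.golden a
  rw [hz.tri_eq h ha ht hm hsm, hz.tri_conj_eq h ha ht hm hsm] at e0
  apply mul_left_cancel₀ (mul_ne_zero (OfNat.ofNat_ne_zero (R := R) 5) (pow_ne_zero 3 hm0))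
  linear_combination -5 * (1 + 2 * (z ^ 2 + z ^ 3)) * e0 - (1 + 2 * (z ^ 2 + z ^ 3)) ^ 2 * hm -
    4 * m ^ 5 * hz.golden

theorem conj_sq_eq : (z ^ 2 - z ^ 3) * t ^ 2 = (1 + (z ^ 2 + z ^ 3)) ^ 2 * (m * s t) -
    (z ^ 2 + z ^ 3) ^ 2 * (z ^ 2 - z ^ 3) * (s (s t) * s (s (s t))) := by
  have := hz.charZero
  have h5 : 1 + 2 * (z ^ 2 + z ^ 3) ≠ 0 := fun h5 ↦ OfNat.ofNat_ne_zero (R := R) 5 <| by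
    linear_combination (1 + 2 * (z ^ 2 + z ^ 3)) * h5 - 4 * hz.golden
  have ht0 : t ≠ 0 := fun ht0 ↦ h0 <| by
    rw [hz.apply_zero_eq h ha ht h0 hm hsm, ht0, zero_mul, zero_mul, zero_mul, mul_zero]
  have e1 := flex_eq_tri hz.golden (twist z a)
  rw [hz.tri_twist_eq h ha ht h0, hz.tri_conj_twist_eq h ha ht h0 hm hsm, ht] at e1
  apply mul_left_cancel₀ (mul_ne_zero h5 (pow_ne_zero 3 ht0))
  linear_combination -e1

theorem dualCovering : DualCovering (-(z ^ 2 + z ^ 3))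
    ![m, (z ^ 2 - z ^ 3) * t, s ((z ^ 2 - z ^ 3) * t), s (s (s ((z ^ 2 - z ^ 3) * t))),
      s (s ((z ^ 2 - z ^ 3) * t))] := by
  have hsum := hz.sum
  have hz5 := hz.pow_five
  have h1 : s ((z ^ 2 - z ^ 3) * t) = (z ^ 4 - z) * s t := by
    rw [map_mul, map_sub, map_pow, map_pow, hz.map]
    linear_combination -z * s t * hz5
  have h2 : s ((z ^ 4 - z) * s t) = (z ^ 3 - z ^ 2) * s (s t) := by
    rw [map_mul, map_sub, map_pow, hz.map]
    linear_combination z ^ 3 * s (s t) * hz5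
  have h3 : s ((z ^ 3 - z ^ 2) * s (s t)) = (z - z ^ 4) * s (s (s t)) := by
    rw [map_mul, map_sub, map_pow, map_pow, hz.map]
    linear_combination z * s (s (s t)) * hz5
  apply hz.dualCovering_of_map_eq hsm <;> rw [h1, h2, h3]
  · rw [hz.sq_eq h ha ht h0 hm hsm]
    clear * - hsum
    grind
  · linear_combination (norm := skip) (z ^ 2 - z ^ 3) * hz.conj_sq_eq h ha ht h0 hm hsm
    clear * - hsum
    grind

end Relations

end CyclotomicFive

end Descent

section Recurrence

variable {R : Type*} [CommRing R] {z : R} {s : R ≃+* R}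

theorem CyclotomicFive.exists_intCast_eq_cycleTerm (hz : CyclotomicFive z s) {m g : R}
    (hm : s m = m) {w : R} (hw : w ^ 5 = 1) (hsw : s w = w ^ 2) :
    ∃ y : ℤ, (y : R) = cycleTerm (twist w ![m, g, s g, s (s (s g)), s (s g)]) := by
  obtain ⟨y, hy⟩ := hz.exists_intCast_of_map_eq
    (x := cycleTerm (twist w ![m, g, s g, s (s (s g)), s (s g)])) <| by
    simp only [cycleTerm, twist, Matrix.cons_val, map_add, map_mul, map_pow, map_ofNat, hm, hsw,
      hz.map_map_map_map]
    linear_combination (w ^ 3 * s (s (s g)) + w * g) * hw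
  exact ⟨y, hy.symm⟩

theorem DualCovering.exists_recurrence [IsDomain R] (hz : CyclotomicFive z s) {m : ℤ} {g : R}
    (h : DualCovering (-(z ^ 2 + z ^ 3)) ![(m : R), g, s g, s (s (s g)), s (s g)]) :
    ∃ y : ZMod 5 → ℤ, (∀ i, y i * y (i + 2) = m ^ 2 + m * y (i + 1)) ∧ ∑ i, y i = 10 * m := by
  have := hz.charZero
  let ψ : AddChar (ZMod 5) R := AddChar.zmodChar 5 hz.pow_five
  have ψ_apply (i : ZMod 5) : ψ i = z ^ i.val := AddChar.zmodChar_apply _ i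
  have hw (i) : ψ i ^ 5 = 1 := by rw [ψ_apply, pow_right_comm, hz.pow_five, one_pow]
  have hsw (i) : s (ψ i) = ψ i ^ 2 := by rw [ψ_apply, map_pow, hz.map, pow_right_comm]
  choose y hy using fun i ↦ hz.exists_intCast_eq_cycleTerm (g := g) (map_intCast s m)
    (hw (2 * i)) (hsw (2 * i))
  refine ⟨y, fun i ↦ ?_, ?_⟩ <;> rw [← Int.cast_inj (α := R)] <;> push_cast
  · have hrec := (h.twist (hw (2 * (i + 1)))).cycleTerm_mul_cycleTerm hz.sum
    have h2 : z ^ 2 * ψ (2 * (i + 1)) = ψ (2 * (i + 2)) := by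
      rw [show 2 * (i + 2) = 2 + 2 * (i + 1) by ring, AddChar.map_add_eq_mul]
      rfl
    have h3 : z ^ 3 * ψ (2 * (i + 1)) = ψ (2 * i) := by
      have h5 : (5 : ZMod 5) = 0 := rfl
      rw [show 2 * i = 3 + 2 * (i + 1) by linear_combination -h5, AddChar.map_add_eq_mul]
      rfl
    rw [twist_twist, twist_twist, h2, h3, ← hy, ← hy, ← hy] at hrec
    exact hrec
  · rw [show ∑ i, (y i : R) = y 0 + y 1 + y 2 + y 3 + y 4 from Fin.sum_univ_five _,
      hy, hy, hy, hy, hy]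
    exact sum_cycleTerm_twist hz.sum _

theorem Covering.exists_recurrence [IsDomain R] (hz : CyclotomicFive z s) {a : Fin 5 → ℤ}
    (h : Covering a) (h0 : a 0 ≠ 0) {m : ℤ} {t : R} (hm : 5 * flex a = m ^ 5)
    (ht : flex (Lyness.twist z (Int.castRingHom R ∘ a)) = (z ^ 2 - z ^ 3) * t ^ 5) :
    ∃ y : ZMod 5 → ℤ, m ≠ 0 ∧ m ∣ a 0 ∧ (∀ i, y i * y (i + 2) = m ^ 2 + m * y (i + 1)) ∧
      ∑ i, y i = 10 * m := by
  have := hz.charZero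
  have hR : Covering (Int.castRingHom R ∘ a) := h.map _
  have ha : s ∘ Int.castRingHom R ∘ a = Int.castRingHom R ∘ a := funext fun _ ↦ map_intCast s _
  have h0' : (Int.castRingHom R ∘ a) 0 ≠ 0 := by simpa using h0
  have hm' : 5 * flex (Int.castRingHom R ∘ a) = (m : R) ^ 5 := by
    rw [← map_flex, eq_intCast]
    exact_mod_cast congrArg (Int.cast (R := R)) hm
  have hsm : s (m : R) = m := map_intCast s m
  have hprod := hz.apply_zero_eq hR ha ht h0' hm' hsm
  have hm0 : (m : R) ≠ 0 := left_ne_zero_of_mul (hprod ▸ h0')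
  obtain ⟨y, hy⟩ := (hz.dualCovering hR ha ht h0' hm' hsm).exists_recurrence hz
  exact ⟨y, by exact_mod_cast hm0, hz.dvd_of_intCast_dvd ⟨_, hprod⟩, hy⟩

end Recurrence

/-- A cycle of length five of the Lyness map `(x, y) ↦ (y, (1 + y) / x)`. -/
def IsLynessCycle {R : Type*} [Add R] [Mul R] [One R] (x : ZMod 5 → R) : Prop :=
  ∀ i, x i * x (i + 2) = 1 + x (i + 1)

theorem prod_zmod_five {M : Type*} [CommMonoid M] (x : ZMod 5 → M) (i : ZMod 5) :
    ∏ j, x j = x i * x (i + 1) * x (i + 2) * x (i + 3) * x (i + 4) := by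
  rw [← Equiv.prod_comp (Equiv.addLeft i) x]
  refine (Fin.prod_univ_five _).trans ?_
  rw [Equiv.coe_addLeft]
  exact congrArg (x · * _ * _ * _ * _) (add_zero i)

theorem prod_comp_add_right {G M : Type*} [AddGroup G] [Fintype G] [CommMonoid M] (g : G)
    (f : G → M) : ∏ i, f (i + g) = ∏ i, f i :=
  Equiv.prod_comp (Equiv.addRight g) f

namespace IsLynessCycle

section CommRing

variable {R : Type*} [CommRing R] {x : ZMod 5 → R}

theorem rotate (h : IsLynessCycle x) (i : ZMod 5) : IsLynessCycle fun j ↦ x (j + i) := fun j ↦ by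
  simpa only [add_right_comm] using h (j + i)

theorem one_add_mul_one_add_mul_one_add (h : IsLynessCycle x) (i : ZMod 5) :
    (1 + x i) * (1 + x (i + 1)) * (1 + x (i + 2)) = (∏ j, x j) * x (i + 1) := by
  have h0 := h i
  have h1 := h (i + 1)
  have h4 := h (i + 4)
  have e0 : i + 4 + 1 = i := by rw [add_assoc]; exact add_zero i
  have e1 : i + 4 + 2 = i + 1 := by rw [add_assoc]; rfl
  have e2 : i + 1 + 1 = i + 2 := by rw [add_assoc]; rfl
  have e3 : i + 1 + 2 = i + 3 := by rw [add_assoc]; rfl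
  rw [e2, e3] at h1
  rw [e0, e1] at h4
  rw [prod_zmod_five x i, ← h0, ← h1, ← h4]
  ring

theorem prod_eq (h : IsLynessCycle x) : ∏ i, x i = ∑ i, x i + 3 := by
  have h0 : x 0 * x 2 = 1 + x 1 := h 0
  have h1 : x 1 * x 3 = 1 + x 2 := h 1
  have h2 : x 2 * x 4 = 1 + x 3 := h 2
  have h4 : x 4 * x 1 = 1 + x 0 := h 4
  rw [show ∏ i, x i = x 0 * x 1 * x 2 * x 3 * x 4 from Fin.prod_univ_five _,
    show ∑ i, x i = x 0 + x 1 + x 2 + x 3 + x 4 from Fin.sum_univ_five _]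
  linear_combination (x 1 * x 3 * x 4 + 1) * h0 + (1 + x 1) * x 4 * h1 + h2 + (1 + x 2) * h4

end CommRing

section Rat

variable {x : ZMod 5 → ℚ}

theorem num_mul_num_mul_den (h : IsLynessCycle x) (i : ZMod 5) :
    (x i).num * (x (i + 2)).num * (x (i + 1)).den =
      (x i).den * (x (i + 2)).den * ((x (i + 1)).den + (x (i + 1)).num) := by
  have hi := h i
  rw [← Rat.num_div_den (x i), ← Rat.num_div_den (x (i + 1)), ← Rat.num_div_den (x (i + 2))] at hi
  field_simp at hi
  exact_mod_cast hi

theorem den_add_num_mul_den_add_num_mul_den_add_num (h : IsLynessCycle x) {q : ℤ}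
    (hq : ∏ i, x i = q) (i : ZMod 5) :
    ((x i).den + (x i).num) * ((x (i + 1)).den + (x (i + 1)).num) *
        ((x (i + 2)).den + (x (i + 2)).num) =
      (x i).den * (x (i + 1)).num * (x (i + 2)).den * q := by
  have hi := h.one_add_mul_one_add_mul_one_add i
  rw [hq, ← Rat.num_div_den (x i), ← Rat.num_div_den (x (i + 1)),
    ← Rat.num_div_den (x (i + 2))] at hi
  field_simp at hi
  exact_mod_cast hi

theorem coprime_den (h : IsLynessCycle x) {q : ℤ} (hq : ∏ i, x i = q) (i : ZMod 5) :
    (x i).den.Coprime (x (i + 2)).den := by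
  rw [← Nat.isCoprime_iff_coprime]
  refine isCoprime_of_prime_dvd (by simp) fun p hp h0 h2 ↦ ?_
  have not_dvd_num (j) (hj : p ∣ (x j).den) : ¬p ∣ (x j).num :=
    fun hj' ↦ hp.not_isUnit ((x j).isCoprime_num_den.isUnit_of_dvd' hj' hj)
  have not_dvd_add (j) (hj : p ∣ (x j).den) : ¬p ∣ (x j).den + (x j).num :=
    fun hj' ↦ not_dvd_num j hj ((dvd_add_right hj).1 hj')
  have h1 : p ∣ (x (i + 1)).den := by
    have hdvd : p ∣ (x i).num * (x (i + 2)).num * (x (i + 1)).den := by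
      rw [h.num_mul_num_mul_den, mul_assoc]
      exact h0.mul_right _
    simpa [hp.dvd_mul, not_dvd_num _ h0, not_dvd_num _ h2] using hdvd
  have hdvd : p ∣ ((x i).den + (x i).num) * ((x (i + 1)).den + (x (i + 1)).num) *
      ((x (i + 2)).den + (x (i + 2)).num) := by
    rw [h.den_add_num_mul_den_add_num_mul_den_add_num hq, mul_assoc, mul_assoc]
    exact h0.mul_right _
  simp [hp.dvd_mul, not_dvd_add _ h0, not_dvd_add _ h1, not_dvd_add _ h2] at hdvd

/-- The part of the denominator that the consecutive terms `x i` and `x (i + 1)` share. -/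
def commonDen (x : ZMod 5 → ℚ) (i : ZMod 5) : ℕ := (x i).den.gcd (x (i + 1)).den

theorem commonDen_ne_zero (x : ZMod 5 → ℚ) (i : ZMod 5) : commonDen x i ≠ 0 :=
  Nat.gcd_ne_zero_left (x i).den_ne_zero

theorem commonDen_dvd_den (x : ZMod 5 → ℚ) (i : ZMod 5) : commonDen x i ∣ (x i).den :=
  Nat.gcd_dvd_left ..

theorem commonDen_dvd_den_add_one (x : ZMod 5 → ℚ) (i : ZMod 5) :
    commonDen x i ∣ (x (i + 1)).den :=
  Nat.gcd_dvd_right ..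

theorem den_eq (h : IsLynessCycle x) {q : ℤ} (hq : ∏ i, x i = q) (i : ZMod 5) :
    (x (i + 1)).den = commonDen x i * commonDen x (i + 1) := by
  have hdvd : (x (i + 1)).den ∣ (x i).den * (x (i + 2)).den := by
    rw [← Rat.natCast_add_den 1, Nat.cast_one, ← h i]
    exact Rat.mul_den_dvd ..
  rw [commonDen, commonDen, add_assoc, one_add_one_eq_two, Nat.gcd_comm (x i).den,
    ← (h.coprime_den hq i).gcd_mul, Nat.gcd_eq_left hdvd]

theorem pairwise_coprime_commonDen (h : IsLynessCycle x) {q : ℤ} (hq : ∏ i, x i = q) :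
    Pairwise (Function.onFun Nat.Coprime (commonDen x)) := by
  have coprime_one (i) : (commonDen x i).Coprime (commonDen x (i + 1)) := by
    have := commonDen_dvd_den_add_one x (i + 1)
    rw [add_assoc, one_add_one_eq_two] at this
    exact (h.coprime_den hq i).of_dvd (commonDen_dvd_den x i) this
  have coprime_two (i) : (commonDen x i).Coprime (commonDen x (i + 2)) :=
    (h.coprime_den hq i).of_dvd (commonDen_dvd_den x i) (commonDen_dvd_den x (i + 2))
  intro i j hij
  obtain ⟨k, rfl⟩ : ∃ k, j = i + k := ⟨j - i, (add_sub_cancel i j).symm⟩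
  have h3 : i + 3 + 2 = i := by rw [add_assoc]; exact add_zero i
  have h4 : i + 4 + 1 = i := by rw [add_assoc]; exact add_zero i
  fin_cases k
  · exact absurd (add_zero i).symm hij
  · exact coprime_one i
  · exact coprime_two i
  · exact (h3 ▸ coprime_two (i + 3)).symm
  · exact (h4 ▸ coprime_one (i + 4)).symm

theorem commonDen_dvd_num (h : IsLynessCycle x) {q : ℤ} (hq : ∏ i, x i = q) (i : ZMod 5) :
    (commonDen x (i + 2) : ℤ) ∣ (x i).num := by
  have hA := h.num_mul_num_mul_den i
  obtain ⟨r, hr⟩ := commonDen_dvd_den x i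
  have h2 := h.den_eq hq (i + 1)
  rw [add_assoc, one_add_one_eq_two] at h2
  rw [hr, h2, h.den_eq hq i] at hA
  have hc : IsCoprime (commonDen x (i + 2) : ℤ) (x (i + 2)).num :=
    (x (i + 2)).isCoprime_num_den.symm.of_isCoprime_of_dvd_left
      (Int.natCast_dvd_natCast.2 (commonDen_dvd_den x (i + 2)))
  refine hc.dvd_of_dvd_mul_right ⟨r * ((x (i + 1)).den + (x (i + 1)).num), ?_⟩
  have hne : (commonDen x i * commonDen x (i + 1) : ℤ) ≠ 0 := by
    simp [commonDen_ne_zero]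
  apply mul_left_cancel₀ hne
  rw [h.den_eq hq i]
  push_cast at hA ⊢
  linear_combination hA

theorem prod_num (h : IsLynessCycle x) {q : ℤ} (hq : ∏ i, x i = q) :
    ∏ i, (x i).num = q * (∏ i, (commonDen x i : ℤ)) ^ 2 := by
  have hden : ∏ i, (x i).den = (∏ i, commonDen x i) ^ 2 := by
    rw [← prod_comp_add_right 1]
    simp only [h.den_eq hq, Finset.prod_mul_distrib, prod_comp_add_right, sq]
  have hne : ∏ i, ((x i).den : ℚ) ≠ 0 := Finset.prod_ne_zero_iff.2 fun i _ ↦ by simp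
  have hnum : ∏ i, ((x i).num : ℚ) = q * ∏ i, ((x i).den : ℚ) := by
    rw [← div_eq_iff hne, ← Finset.prod_div_distrib, ← hq]
    exact Finset.prod_congr rfl fun i _ ↦ Rat.num_div_den (x i)
  have hnum' : ∏ i, (x i).num = q * ((∏ i, (x i).den : ℕ) : ℤ) := by exact_mod_cast hnum
  rw [hnum', hden]
  push_cast
  rfl

theorem exists_num_eq_mul (h : IsLynessCycle x) {q : ℤ} (hq : ∏ i, x i = q) :
    ∃ r : ZMod 5 → ℤ, (∀ i, (x i).num = commonDen x (i + 2) * r i) ∧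
      (∀ i, r i * r (i + 2) = (x (i + 1)).den + (x (i + 1)).num) ∧
      ∏ i, r i = q * ∏ i, (commonDen x i : ℤ) := by
  choose r hr using h.commonDen_dvd_num hq
  refine ⟨r, hr, fun i ↦ ?_, ?_⟩
  · have hA := h.num_mul_num_mul_den i
    have d0 := h.den_eq hq (i + 4)
    have d2 := h.den_eq hq (i + 1)
    have hr2 := hr (i + 2)
    have e0 : i + 4 + 1 = i := by rw [add_assoc]; exact add_zero i
    have e2 : i + 1 + 1 = i + 2 := by rw [add_assoc]; rfl
    have e4 : i + 2 + 2 = i + 4 := by rw [add_assoc]; rfl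
    rw [e0] at d0
    rw [e2] at d2
    rw [e4] at hr2
    rw [hr i, hr2, d0, d2, h.den_eq hq i] at hA
    have hne : (commonDen x i * commonDen x (i + 1) * commonDen x (i + 2) * commonDen x (i + 4)
      : ℤ) ≠ 0 := by simp [commonDen_ne_zero]
    apply mul_left_cancel₀ hne
    rw [h.den_eq hq i]
    push_cast at hA ⊢
    linear_combination hA
  · have hne : ∏ i, (commonDen x i : ℤ) ≠ 0 :=
      Finset.prod_ne_zero_iff.2 fun i _ ↦ by simp [commonDen_ne_zero]
    apply mul_left_cancel₀ hne
    have hnum := h.prod_num hq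
    simp only [hr, Finset.prod_mul_distrib] at hnum
    rw [prod_comp_add_right 2 fun i ↦ (commonDen x i : ℤ)] at hnum
    linear_combination hnum

theorem isCoprime_commonDen_mul {r : ZMod 5 → ℤ}
    (hr : ∀ i, r i * r (i + 2) = (x (i + 1)).den + (x (i + 1)).num) (i : ZMod 5) :
    IsCoprime (commonDen x i : ℤ) (r i * r (i + 2) * (r (i + 4) * r (i + 1))) := by
  have isCoprime_den (j) : IsCoprime ((x (j + 1)).den : ℤ) (r j * r (j + 2)) := by
    simpa [hr, add_comm] using (x (j + 1)).isCoprime_num_den.symm.add_mul_left_right 1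
  have e0 : i + 4 + 1 = i := by rw [add_assoc]; exact add_zero i
  have e1 : i + 4 + 2 = i + 1 := by rw [add_assoc]; rfl
  have h4 := isCoprime_den (i + 4)
  rw [e0, e1] at h4
  exact ((isCoprime_den i).of_isCoprime_of_dvd_left
    (Int.natCast_dvd_natCast.2 (commonDen_dvd_den_add_one x i))).mul_right
    (h4.of_isCoprime_of_dvd_left (Int.natCast_dvd_natCast.2 (commonDen_dvd_den x i)))

theorem exists_num_eq_mul_sq (h : IsLynessCycle x) {q : ℤ} (hq : ∏ i, x i = q) :
    ∃ k : ZMod 5 → ℤ, ∏ i, k i = q ∧ ∀ i, (x i).num = k i * (commonDen x (i + 2)) ^ 2 := by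
  obtain ⟨r, hnum, hr, hprod⟩ := h.exists_num_eq_mul hq
  have hdvd (i) : (commonDen x (i + 2) : ℤ) ∣ r i := by
    have hc := isCoprime_commonDen_mul hr (i + 2)
    have e0 : i + 2 + 3 = i := by rw [add_assoc]; exact add_zero i
    have hi : (commonDen x (i + 2) : ℤ) ∣ ∏ j, r j :=
      hprod ▸ (Finset.dvd_prod_of_mem _ (Finset.mem_univ _)).mul_left q
    have hsplit :
        ∏ j, r j = r i * (r (i + 2) * r (i + 2 + 2) * (r (i + 2 + 4) * r (i + 2 + 1))) := by
      rw [prod_zmod_five r (i + 2), e0]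
      ring
    exact hc.dvd_of_dvd_mul_right (hsplit ▸ hi)
  choose k hk using hdvd
  refine ⟨k, ?_, fun i ↦ by rw [hnum, hk]; ring⟩
  have hne : ∏ i, (commonDen x i : ℤ) ≠ 0 :=
    Finset.prod_ne_zero_iff.2 fun i _ ↦ by simp [commonDen_ne_zero]
  apply mul_left_cancel₀ hne
  simp only [hk, Finset.prod_mul_distrib] at hprod
  rw [prod_comp_add_right 2 fun i ↦ (commonDen x i : ℤ)] at hprod
  linear_combination hprod

end Rat

end IsLynessCycle

theorem exists_units_of_prod_eq_prime {ι M : Type*} [Fintype ι] [DecidableEq ι]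
    [CommMonoidWithZero M] [IsCancelMulZero M] {p : M} (hp : Prime p) {k : ι → M}
    (hk : ∏ i, k i = p) :
    ∃ (i : ι) (u : ι → Mˣ), ∏ j, u j = 1 ∧ ∀ j, k j = (if j = i then p else 1) * u j := by
  obtain ⟨i, -, v, hv⟩ := hp.exists_mem_finset_dvd (hk ▸ dvd_rfl : p ∣ ∏ i, k i)
  have hprod : ∏ j, Function.update k i v j = 1 := by
    apply mul_left_cancel₀ hp.ne_zero
    rw [Finset.prod_update_of_mem (Finset.mem_univ i), mul_one, ← mul_assoc, ← hv, ← hk,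
      ← Finset.mul_prod_erase _ _ (Finset.mem_univ i), Finset.sdiff_singleton_eq_erase]
  have hunit (j) : IsUnit (Function.update k i v j) :=
    isUnit_of_dvd_one (hprod ▸ Finset.dvd_prod_of_mem _ (Finset.mem_univ j))
  refine ⟨i, fun j ↦ (hunit j).unit, Units.ext ?_, fun j ↦ ?_⟩
  · simpa using hprod
  · rcases eq_or_ne j i with rfl | hj
    · simp [hv]
    · simp [hj]

theorem exists_units_mul_eq {u : ZMod 5 → ℤˣ} (hu : ∏ i, u i = 1) :
    ∃ e : ZMod 5 → ℤˣ, ∀ i, e (i + 4) * e i = u i := by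
  refine ⟨![1, u 1, u 1 * u 2, u 1 * u 2 * u 3, u 1 * u 2 * u 3 * u 4], fun i ↦ ?_⟩
  rw [prod_zmod_five u 0] at hu
  simp only [zero_add] at hu
  have hu4 : u 1 * u 2 * u 3 * u 4 = u 0 :=
    mul_left_cancel (a := u 0) <| by rw [Int.units_mul_self, ← hu]; simp only [mul_assoc]
  fin_cases i
  · exact (mul_one _).trans hu4
  · exact one_mul _
  · change u 1 * (u 1 * u 2) = u 2
    rw [← mul_assoc, Int.units_mul_self, one_mul]
  · change u 1 * u 2 * (u 1 * u 2 * u 3) = u 3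
    rw [← mul_assoc, Int.units_mul_self, one_mul]
  · change u 1 * u 2 * u 3 * (u 1 * u 2 * u 3 * u 4) = u 4
    rw [← mul_assoc, Int.units_mul_self, one_mul]

namespace IsLynessCycle

theorem exists_mul_eq_mul_sq {x : ZMod 5 → ℚ} (h : IsLynessCycle x) {p : ℤ} (hp : Prime p)
    (hprod : ∏ i, x i = p) :
    ∃ (i : ZMod 5) (d : ZMod 5 → ℤ), Pairwise (Function.onFun IsCoprime d) ∧
      (∀ j, d j ≠ 0 ∧ d j ∣ (x j).den) ∧
      ∀ j, x j * (d (j + 4) * d j) = ((if j = i then p else 1 : ℤ) : ℚ) * d (j + 2) ^ 2 := by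
  obtain ⟨k, hk, hnum⟩ := h.exists_num_eq_mul_sq hprod
  obtain ⟨i, u, hu, hku⟩ := exists_units_of_prod_eq_prime hp hk
  obtain ⟨e, he⟩ := exists_units_mul_eq hu
  refine ⟨i, fun j ↦ e j * commonDen x j, fun j l hjl ↦ ?_, fun j ↦ ⟨?_, ?_⟩, fun j ↦ ?_⟩
  · have hc : IsCoprime (commonDen x j : ℤ) (commonDen x l) :=
      Nat.isCoprime_iff_coprime.2 (h.pairwise_coprime_commonDen hprod hjl)
    exact (isCoprime_mul_unit_left_left (e j).isUnit _ _).2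
      ((isCoprime_mul_unit_left_right (e l).isUnit _ _).2 hc)
  · simp [commonDen_ne_zero]
  · rw [Units.mul_left_dvd]
    exact Int.natCast_dvd_natCast.2 (commonDen_dvd_den x j)
  · have e0 : j + 4 + 1 = j := by rw [add_assoc]; exact add_zero j
    have hden := h.den_eq hprod (j + 4)
    rw [e0] at hden
    have hu2 : ((u j : ℤ) : ℚ) * (u j : ℤ) = 1 := by
      exact_mod_cast Int.units_coe_mul_self (u j)
    have he2 : ((e (j + 2) : ℤ) : ℚ) * (e (j + 2) : ℤ) = 1 := by
      exact_mod_cast Int.units_coe_mul_self (e (j + 2))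
    have hej : ((e (j + 4) : ℤ) : ℚ) * (e j : ℤ) = (u j : ℤ) := by
      exact_mod_cast congrArg Units.val (he j)
    have hx : x j * (commonDen x (j + 4) * commonDen x j) =
        (if j = i then p else 1 : ℤ) * (u j : ℤ) * (commonDen x (j + 2)) ^ 2 := by
      have := Rat.mul_den_eq_num (x j)
      rw [hden, hnum, hku] at this
      exact_mod_cast this
    simp only [Int.cast_mul, Int.cast_natCast]
    linear_combination x j * commonDen x (j + 4) * commonDen x j * hej + (u j : ℤ) * hx +
      ((if j = i then p else 1 : ℤ) : ℚ) * commonDen x (j + 2) ^ 2 * (hu2 - he2)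

theorem mul_mul_eq_add {K : Type*} [Field K] {x : ZMod 5 → K} (h : IsLynessCycle x)
    {d P : ZMod 5 → K} (hd : ∀ j, d j ≠ 0)
    (hx : ∀ j, x j * (d (j + 4) * d j) = P j * d (j + 2) ^ 2) (j : ZMod 5) :
    P j * P (j + 2) * (d (j + 2) * d (j + 4)) = d j * d (j + 1) + P (j + 1) * d (j + 3) ^ 2 := by
  have h1 := hx (j + 1)
  have h2 := hx (j + 2)
  simp only [add_assoc] at h1 h2
  have e5 : j + (1 + 4) = j := add_zero j
  have e6 : j + (2 + 4) = j + 1 := rfl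
  have e3 : j + (1 + 2) = j + 3 := rfl
  have e4 : j + (2 + 2) = j + 4 := rfl
  rw [e5, e3] at h1
  rw [e6, e4] at h2
  apply mul_left_cancel₀ (mul_ne_zero (mul_ne_zero (hd j) (hd (j + 1)))
    (mul_ne_zero (hd (j + 2)) (hd (j + 4))))
  linear_combination (-(d j * d (j + 1) * (P (j + 2) * d (j + 4) ^ 2))) * hx j -
    x j * (d (j + 4) * d j) * (d j * d (j + 1)) * h2 +
    d j * d (j + 1) * d (j + 4) * d j * d (j + 1) * d (j + 2) * h j +
    d j * d (j + 2) * d (j + 4) * d (j + 1) * h1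

theorem exists_covering {x : ZMod 5 → ℚ} (h : IsLynessCycle x) (hprod : ∏ i, x i = 13) {m : ℤ}
    (hm : ∀ i, ((x i).den : ℤ) ∣ m) :
    ∃ a : Fin 5 → ℤ, Covering a ∧ IsCoprime (a 1) (a 2) ∧ ∏ i, a i ∣ m ∧ ∏ i, a i ≠ 0 := by
  obtain ⟨i, d, hcop, hd, hx⟩ := h.exists_mul_eq_mul_sq
    (show Prime (13 : ℤ) by norm_num) (by exact_mod_cast hprod)
  have hrel (j : ZMod 5) : (if j = 0 then 13 else 1) * (if j + 2 = 0 then 13 else 1) *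
      (d (j + 2 + i) * d (j + 4 + i)) =
        d (j + i) * d (j + 1 + i) + (if j + 1 = 0 then 13 else 1) * d (j + 3 + i) ^ 2 := by
    have := (h.rotate i).mul_mul_eq_add (d := fun j ↦ (d (j + i) : ℚ))
      (P := fun j ↦ ((if j = 0 then 13 else 1 : ℤ) : ℚ)) (fun j ↦ Int.cast_ne_zero.2 (hd _).1)
      (fun j ↦ by simpa only [add_right_comm, add_eq_right] using hx (j + i)) j
    exact_mod_cast this
  have hprod : ∏ j, ![d (2 + i), d i, d (3 + i), -d (1 + i), -d (4 + i)] j = ∏ j, d j := by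
    rw [Fin.prod_univ_five, prod_zmod_five d i]
    simp only [Matrix.cons_val, add_comm i]
    ring
  refine ⟨![d (2 + i), d i, d (3 + i), -d (1 + i), -d (4 + i)], ?_, ?_, ?_, ?_⟩
  · have h0 : 13 * 1 * (d (2 + i) * d (4 + i)) = d (0 + i) * d (1 + i) + 1 * d (3 + i) ^ 2 := hrel 0
    have h1 : 1 * 1 * (d (3 + i) * d (0 + i)) = d (1 + i) * d (2 + i) + 1 * d (4 + i) ^ 2 := hrel 1
    have h2 : 1 * 1 * (d (4 + i) * d (1 + i)) = d (2 + i) * d (3 + i) + 1 * d (0 + i) ^ 2 := hrel 2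
    have h3 : 1 * 13 * (d (0 + i) * d (2 + i)) = d (3 + i) * d (4 + i) + 1 * d (1 + i) ^ 2 := hrel 3
    have h4 : 1 * 1 * (d (1 + i) * d (3 + i)) = d (4 + i) * d (0 + i) + 13 * d (2 + i) ^ 2 := hrel 4
    rw [zero_add] at h0 h1 h2 h3 h4
    constructor <;> simp only [Matrix.cons_val] <;> linarith
  · exact hcop (mt right_eq_add.1 (by decide))
  · rw [hprod]
    exact Finset.prod_dvd_of_coprime (fun j _ l _ hjl ↦ hcop hjl) fun j _ ↦ (hd j).2.trans (hm j)
  · rw [hprod]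
    exact Finset.prod_ne_zero_iff.2 fun j _ ↦ (hd j).1

end IsLynessCycle

theorem IsLynessCycle.of_mul_eq {K : Type*} [Field K] {y : ZMod 5 → K} {m : K} (hm : m ≠ 0)
    (hy : ∀ i, y i * y (i + 2) = m ^ 2 + m * y (i + 1)) : IsLynessCycle fun i ↦ y i / m :=
  fun i ↦ by
  field_simp
  linear_combination hy i

/-- The orbit of `(x, y)` under the Lyness map. -/
def lynessCycle {K : Type*} [Field K] (x y : K) : ZMod 5 → K :=
  ![x, y, (1 + y) / x, (1 + x + y) / (x * y), (1 + x) / y]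

theorem isLynessCycle_lynessCycle {K : Type*} [Field K] {x y : K} (hx : x ≠ 0) (hy : y ≠ 0) :
    IsLynessCycle (lynessCycle x y) := by
  intro i
  fin_cases i
  · exact mul_div_cancel₀ _ hx
  · change y * ((1 + x + y) / (x * y)) = 1 + (1 + y) / x
    field_simp
    ring
  · change (1 + y) / x * ((1 + x) / y) = 1 + (1 + x + y) / (x * y)
    field_simp
    ring
  · change (1 + x + y) / (x * y) * x = 1 + (1 + x) / y
    field_simp
    ring
  · exact div_mul_cancel₀ _ hy

namespace Covering

theorem exists_dvd {a : Fin 5 → ℤ} (h : Covering a) (hc : IsCoprime (a 1) (a 2))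
    (ha0 : a 0 ≠ 0) : ∃ a' : Fin 5 → ℤ, Covering a' ∧ IsCoprime (a' 1) (a' 2) ∧
      ∏ i, a' i ∣ a 0 ∧ ∏ i, a' i ≠ 0 := by
  obtain ⟨R, _, _, _, z, s, hz⟩ := exists_cyclotomicFive
  obtain ⟨m, t, hm, ht⟩ := h.exists_fifth_powers hz hc ha0
  obtain ⟨y, hm0, hma, hy, hsum⟩ := h.exists_recurrence hz ha0 hm ht
  have hm0' : (m : ℚ) ≠ 0 := Int.cast_ne_zero.2 hm0
  have hcycle : IsLynessCycle fun i ↦ (y i / m : ℚ) := .of_mul_eq hm0' fun i ↦ by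
    exact_mod_cast hy i
  have hprod : ∏ i, (y i / m : ℚ) = 13 := by
    rw [hcycle.prod_eq, ← Finset.sum_div, ← Int.cast_sum, hsum, Int.cast_mul]
    linear_combination 10 * div_self hm0'
  obtain ⟨a', h', hc', hdvd, hne⟩ := hcycle.exists_covering hprod (m := m) fun i ↦ by
    simpa only [Rat.divInt_eq_div] using Rat.den_dvd (y i) m
  exact ⟨a', h', hc', hdvd.trans hma, hne⟩

theorem eq_zero_of_isUnit {a : Fin 5 → ℤ} (h : Covering a) (hu : IsUnit (a 1 * a 2 * a 3 * a 4)) :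
    a 0 = 0 := by
  simp only [IsUnit.mul_iff, Int.isUnit_iff] at hu
  obtain ⟨⟨⟨h1, h2⟩, h3⟩, h4⟩ := hu
  have e := h.e4
  rcases h1 with h1 | h1 <;> rcases h2 with h2 | h2 <;> rcases h3 with h3 | h3 <;>
    rcases h4 with h4 | h4 <;> rw [h1, h2, h3, h4] at e <;> lia

theorem eq_zero {a : Fin 5 → ℤ} (h : Covering a) (hc : IsCoprime (a 1) (a 2)) : a 0 = 0 := by
  have hwf := wellFounded_dvdNotUnit (α := ℤ)
  induction hn : a 0 using hwf.induction generalizing a with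
  | _ n ih =>
    by_contra hn0
    obtain ⟨a', h', hc', ⟨b, hb⟩, hne⟩ := h.exists_dvd hc (hn ▸ hn0)
    have hprod : ∏ i, a' i = a' 0 * (a' 1 * a' 2 * a' 3 * a' 4) := by
      rw [Fin.prod_univ_five]
      ring
    rw [hprod] at hne hb
    have h0 := left_ne_zero_of_mul hne
    refine h0 (ih _ ⟨h0, a' 1 * a' 2 * a' 3 * a' 4 * b, fun hu ↦ h0 ?_, ?_⟩ h' hc' rfl)
    · exact h'.eq_zero_of_isUnit (isUnit_of_mul_isUnit_left hu)
    · exact hn ▸ hb.trans (mul_assoc _ _ b)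

end Covering

theorem mul_eq_zero_of_curve {x y : ℚ} (h : (x + 1) * (y + 1) * (x + y + 1) = 13 * x * y) :
    x * y = 0 := by
  by_contra hxy
  obtain ⟨hx, hy⟩ := mul_ne_zero_iff.1 hxy
  have hprod : ∏ i, lynessCycle x y i = 13 := by
    refine (Fin.prod_univ_five _).trans ?_
    simp only [lynessCycle, Matrix.cons_val]
    field_simp
    linear_combination h
  obtain ⟨a, ha, hc, -, hne⟩ := (isLynessCycle_lynessCycle hx hy).exists_covering hprod
    fun i ↦ Finset.dvd_prod_of_mem (fun i ↦ ((lynessCycle x y i).den : ℤ)) (Finset.mem_univ i)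
  exact hne (Finset.prod_eq_zero (Finset.mem_univ 0) (ha.eq_zero hc))

section Chord

variable {h : ℚ}

/-- The gradient of `cubic h`; the tangent line at a point `p` of the cubic consists of the `q` with
`gradient h p ⬝ᵥ q = 0`. -/
def gradient (h : ℚ) (p : Fin 3 → ℚ) : Fin 3 → ℚ :=
  ![(p 1 + p 2) * (p 0 + p 1 + p 2) + (p 0 + p 2) * (p 1 + p 2) - h * (p 1 * p 2),
    (p 0 + p 2) * (p 0 + p 1 + p 2) + (p 0 + p 2) * (p 1 + p 2) - h * (p 0 * p 2),
    (p 1 + p 2) * (p 0 + p 1 + p 2) + (p 0 + p 2) * (p 0 + p 1 + p 2) + (p 0 + p 2) * (p 1 + p 2) -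
      h * (p 0 * p 1)]

theorem cubic_smul_add_smul (h s t : ℚ) (p q : Fin 3 → ℚ) :
    cubic h (s • p + t • q) = s ^ 3 * cubic h p + s ^ 2 * t * (gradient h p ⬝ᵥ q) +
      s * t ^ 2 * (gradient h q ⬝ᵥ p) + t ^ 3 * cubic h q := by
  simp only [cubic, gradient, dotProduct, Fin.sum_univ_three, Matrix.cons_val, Pi.add_apply,
    Pi.smul_apply, smul_eq_mul]
  ring

/-- The third intersection point of the cubic with the line through the points `p` and `q` of it. -/
def chordPoint (h : ℚ) (p q : Fin 3 → ℚ) : Fin 3 → ℚ :=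
  (gradient h q ⬝ᵥ p) • p - (gradient h p ⬝ᵥ q) • q

theorem rep_mem_submodule (P : E h) : P.1.rep ∈ P.1.submodule := by
  rw [Projectivization.submodule_eq]
  exact Submodule.mem_span_singleton_self _

theorem eq_of_mem_submodule {P Q : E h} {p : Fin 3 → ℚ} (hp : p ≠ 0) (hP : p ∈ P.1.submodule)
    (hQ : p ∈ Q.1.submodule) : P = Q := by
  rw [Projectivization.submodule_eq, Submodule.mem_span_singleton] at hP hQ
  obtain ⟨a, rfl⟩ := hP
  obtain ⟨b, hb⟩ := hQ
  refine Subtype.ext ?_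
  rw [← P.1.mk_rep, ← Q.1.mk_rep, Projectivization.mk_eq_mk_iff']
  refine ⟨a⁻¹ * b, ?_⟩
  rw [mul_smul, hb, inv_smul_smul₀ (left_ne_zero_of_smul hp)]

theorem exists_eq_smul_of_mem_submodule {P : E h} {p q : Fin 3 → ℚ} (hp : p ≠ 0)
    (hP : p ∈ P.1.submodule) (hQ : q ∈ P.1.submodule) : ∃ c : ℚ, q = c • p := by
  rw [Projectivization.submodule_eq, Submodule.mem_span_singleton] at hP hQ
  obtain ⟨a, rfl⟩ := hP
  obtain ⟨b, rfl⟩ := hQ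
  exact ⟨b * a⁻¹, by rw [mul_smul, inv_smul_smul₀ (left_ne_zero_of_smul hp)]⟩

theorem linearIndependent_of_ne {P Q : E h} (hPQ : P ≠ Q) {p q : Fin 3 → ℚ} (hp : p ≠ 0)
    (hq : q ≠ 0) (hP : p ∈ P.1.submodule) (hQ : q ∈ Q.1.submodule) :
    LinearIndependent ℚ ![p, q] := by
  rw [LinearIndependent.pair_iff' hp]
  rintro c rfl
  exact hPQ (eq_of_mem_submodule hq (P.1.submodule.smul_mem c hP) hQ)

theorem LineMeets.rotate {P Q R : E h} (H : LineMeets h P Q R) : LineMeets h Q R P := by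
  obtain ⟨u, v, huv, a, b, c, ha, hb, hc, hP, hQ, hR, k, hk, hF⟩ := H
  exact ⟨u, v, huv, b, c, a, hb, hc, ha, hQ, hR, hP, k, hk, fun s t => by rw [hF]; ring⟩

theorem smul_add_smul_ne_zero {u v : Fin 3 → ℚ} {a : Fin 2 → ℚ}
    (huv : LinearIndependent ℚ ![u, v]) (ha : a ≠ 0) : a 0 • u + a 1 • v ≠ 0 := fun h0 ↦ ha <| by
  obtain ⟨h1, h2⟩ := LinearIndependent.pair_iff.1 huv _ _ h0
  ext j
  fin_cases j <;> assumption

theorem exists_smul_add_smul_eq {u v p : Fin 3 → ℚ} {a : Fin 2 → ℚ} {P : E h}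
    (huv : LinearIndependent ℚ ![u, v]) (ha : a ≠ 0) (hP : a 0 • u + a 1 • v ∈ P.1.submodule)
    (hp : p ≠ 0) (hp' : p ∈ P.1.submodule) :
    ∃ c : ℚ, c ≠ 0 ∧ p = (c * a 0) • u + (c * a 1) • v := by
  obtain ⟨c, hc⟩ := exists_eq_smul_of_mem_submodule (smul_add_smul_ne_zero huv ha) hP hp'
  refine ⟨c, ?_, ?_⟩
  · rintro rfl
    exact hp (hc.trans (zero_smul ..))
  · rw [hc, smul_add, smul_smul, smul_smul]

theorem LineMeets.exists_eq {P Q R : E h} (H : LineMeets h P Q R) {p q r : Fin 3 → ℚ}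
    (hp : p ≠ 0) (hq : q ≠ 0) (hr : r ≠ 0) (hP : p ∈ P.1.submodule) (hQ : q ∈ Q.1.submodule)
    (hR : r ∈ R.1.submodule) :
    ∃ u v : Fin 3 → ℚ, LinearIndependent ℚ ![u, v] ∧ ∃ a b c : Fin 2 → ℚ,
      p = a 0 • u + a 1 • v ∧ q = b 0 • u + b 1 • v ∧ r = c 0 • u + c 1 • v ∧
      ∃ k : ℚ, k ≠ 0 ∧ ∀ s t : ℚ, cubic h (s • u + t • v) =
        k * (s * a 1 - t * a 0) * (s * b 1 - t * b 0) * (s * c 1 - t * c 0) := by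
  obtain ⟨u, v, huv, a, b, c, ha, hb, hc, hP', hQ', hR', k, hk, hF⟩ := H
  obtain ⟨α, hα, hpa⟩ := exists_smul_add_smul_eq huv ha hP' hp hP
  obtain ⟨β, hβ, hqb⟩ := exists_smul_add_smul_eq huv hb hQ' hq hQ
  obtain ⟨γ, hγ, hrc⟩ := exists_smul_add_smul_eq huv hc hR' hr hR
  refine ⟨u, v, huv, α • a, β • b, γ • c, hpa, hqb, hrc, k / (α * β * γ),
    div_ne_zero hk (mul_ne_zero (mul_ne_zero hα hβ) hγ), fun s t ↦ ?_⟩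
  rw [hF]
  simp only [Pi.smul_apply, smul_eq_mul]
  field_simp

theorem LineMeets.chordPoint_eq_smul {P Q R : E h} (H : LineMeets h P Q R) (hPQ : P ≠ Q)
    {p q r : Fin 3 → ℚ}
    (hp : p ≠ 0) (hq : q ≠ 0) (hr : r ≠ 0) (hP : p ∈ P.1.submodule) (hQ : q ∈ Q.1.submodule)
    (hR : r ∈ R.1.submodule) : ∃ c : ℚ, c ≠ 0 ∧ chordPoint h p q = c • r := by
  have hpq := linearIndependent_of_ne hPQ hp hq hP hQ
  obtain ⟨u, v, _, a, b, c, hpa, hqb, hrc, k, hk, hF⟩ := H.exists_eq hp hq hr hP hQ hR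
  have hF' (s t : ℚ) : s ^ 2 * t * (gradient h p ⬝ᵥ q) + s * t ^ 2 * (gradient h q ⬝ᵥ p) =
      -k * (a 0 * b 1 - a 1 * b 0) ^ 2 * s * t *
        (s * (a 0 * c 1 - a 1 * c 0) + t * (b 0 * c 1 - b 1 * c 0)) := by
    have hst : s • p + t • q = (s * a 0 + t * b 0) • u + (s * a 1 + t * b 1) • v := by
      rw [hpa, hqb]
      module
    have := cubic_smul_add_smul h s t p q
    rw [P.2 p hP, Q.2 q hQ, hst, hF] at this
    linear_combination -this
  have hpq' : gradient h p ⬝ᵥ q = -k * (a 0 * b 1 - a 1 * b 0) ^ 2 * (a 0 * c 1 - a 1 * c 0) := by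
    linear_combination (hF' 1 1 - hF' 1 (-1)) / 2
  have hqp' : gradient h q ⬝ᵥ p = -k * (a 0 * b 1 - a 1 * b 0) ^ 2 * (b 0 * c 1 - b 1 * c 0) := by
    linear_combination (hF' 1 1 + hF' 1 (-1)) / 2
  have hab : a 0 * b 1 ≠ a 1 * b 0 :=
    ((LinearIndependent.pair_add_smul_add_smul_iff _ _ _ _).1 (hqb ▸ hpa ▸ hpq)).2
  refine ⟨k * (a 0 * b 1 - a 1 * b 0) ^ 3, mul_ne_zero hk (pow_ne_zero 3 (sub_ne_zero.2 hab)), ?_⟩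
  rw [chordPoint, hpq', hqp', hpa, hqb, hrc]
  module

theorem lineMeets_iff_of_ne {P Q R : E h} (hPQ : P ≠ Q) {p q : Fin 3 → ℚ}
    (hp : p ≠ 0) (hq : q ≠ 0) (hP : p ∈ P.1.submodule) (hQ : q ∈ Q.1.submodule) :
    LineMeets h P Q R ↔ chordPoint h p q ≠ 0 ∧ chordPoint h p q ∈ R.1.submodule := by
  constructor
  · intro H
    obtain ⟨c, hc, hr⟩ := H.chordPoint_eq_smul hPQ hp hq R.1.rep_nonzero hP hQ (rep_mem_submodule R)
    rw [hr]
    exact ⟨smul_ne_zero hc R.1.rep_nonzero, Submodule.smul_mem _ _ (rep_mem_submodule R)⟩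
  · rintro ⟨hne, hR⟩
    refine ⟨p, q, linearIndependent_of_ne hPQ hp hq hP hQ, ![1, 0], ![0, 1],
      ![gradient h q ⬝ᵥ p, -(gradient h p ⬝ᵥ q)], ?_, ?_, ?_, ?_, ?_, ?_, 1, one_ne_zero, ?_⟩
    · simp
    · simp
    · intro h0
      have hqp : gradient h q ⬝ᵥ p = 0 := congrFun h0 0
      have hpq : gradient h p ⬝ᵥ q = 0 := neg_eq_zero.1 (congrFun h0 1)
      exact hne (by rw [chordPoint, hqp, hpq, zero_smul, zero_smul, sub_zero])
    · simpa
    · simpa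
    · simpa [chordPoint, sub_eq_add_neg] using hR
    · intro s t
      rw [cubic_smul_add_smul, P.2 p hP, Q.2 q hQ]
      simp only [Matrix.cons_val]
      ring

theorem exists_eq_smul_add_smul_of_dotProduct_eq_zero {g u v w : Fin 3 → ℚ} (hg : g ≠ 0)
    (huv : LinearIndependent ℚ ![u, v]) (hu : g ⬝ᵥ u = 0) (hv : g ⬝ᵥ v = 0) (hw : g ⬝ᵥ w = 0) :
    ∃ s t : ℚ, w = s • u + t • v := by
  by_contra hne
  have hli : LinearIndependent ℚ (Matrix.of ![w, u, v]).row := by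
    refine linearIndependent_finCons.2 ⟨huv, fun hmem ↦ hne ?_⟩
    obtain ⟨s, t, hst⟩ := Submodule.mem_span_pair.1 (by simpa using hmem)
    exact ⟨t, s, by rw [← hst, add_comm]⟩
  have hinj := Matrix.mulVec_injective_iff_isUnit.2 (Matrix.linearIndependent_rows_iff_isUnit.1 hli)
  refine hg (hinj ?_)
  rw [Matrix.mulVec_zero]
  ext j
  rw [Matrix.mulVec, dotProduct_comm]
  fin_cases j
  exacts [hw, hu, hv]

theorem LineMeets.eq_of_dotProduct_eq_zero {P Q : E h} (H : LineMeets h P P P) {p q : Fin 3 → ℚ}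
    (hp : p ≠ 0) (hq : q ≠ 0) (hP : p ∈ P.1.submodule) (hQ : q ∈ Q.1.submodule)
    (hg : gradient h p ≠ 0) (hpq : gradient h p ⬝ᵥ q = 0) : Q = P := by
  obtain ⟨u, v, huv, a, b, c, hpa, hpb, hpc, k, hk, hF⟩ := H.exists_eq hp hp hp hP hP hP
  have eq_of_eq {d : Fin 2 → ℚ} (hd : p = d 0 • u + d 1 • v) : d = a := by
    obtain ⟨h0, h1⟩ := huv.eq_of_pair (hd.symm.trans hpa)
    ext i
    fin_cases i <;> assumption
  obtain rfl := eq_of_eq hpb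
  obtain rfl := eq_of_eq hpc
  have hline (s t : ℚ) : gradient h p ⬝ᵥ (s • u + t • v) = 0 := by
    have expand (x : ℚ) : cubic h (p + x • (s • u + t • v)) =
        k * x ^ 3 * (s * c 1 - t * c 0) ^ 3 := by
      have : p + x • (s • u + t • v) = (c 0 + x * s) • u + (c 1 + x * t) • v := by
        rw [hpa]
        module
      rw [this, hF]
      ring
    have taylor (x : ℚ) := cubic_smul_add_smul h 1 x p (s • u + t • v)
    simp only [one_smul, expand, P.2 p hP] at taylor
    linear_combination taylor (-1) / 3 + taylor 2 / 6 - taylor 1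
  obtain ⟨s, t, rfl⟩ := exists_eq_smul_add_smul_of_dotProduct_eq_zero hg huv
    (by simpa using hline 1 0) (by simpa using hline 0 1) hpq
  have hst : s * c 1 - t * c 0 = 0 := by
    have := Q.2 _ hQ
    rw [hF] at this
    simpa [hk] using this
  by_contra hne
  have hli := linearIndependent_of_ne hne hq hp hQ hP
  rw [hpc] at hli
  exact ((LinearIndependent.pair_add_smul_add_smul_iff _ _ _ _).1 hli).2 (sub_eq_zero.1 hst)

end Chord

section Torsion

variable {h : ℚ}

/-- Homogeneous coordinates of the multiples of the point `[0 : 1 : 0]` of order five, which lie on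
`E h` for every `h`. -/
def coord : ZMod 5 → Fin 3 → ℚ :=
  (![![1, -1, 0], ![0, 1, 0], ![0, -1, 1], ![-1, 0, 1], ![1, 0, 0]] : Fin 5 → Fin 3 → ℚ)

theorem coord_ne_zero (i : ZMod 5) : coord i ≠ 0 := by
  intro h0
  fin_cases i
  exacts [one_ne_zero (congrFun h0 0), one_ne_zero (congrFun h0 1), one_ne_zero (congrFun h0 2),
    one_ne_zero (congrFun h0 2), one_ne_zero (congrFun h0 0)]

theorem cubic_coord (h : ℚ) (i : ZMod 5) : cubic h (coord i) = 0 := by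
  fin_cases i <;> simp [cubic, coord]

/-- The `i`-th multiple of `[0 : 1 : 0]` on `E h`. -/
def torsionPoint (h : ℚ) (i : ZMod 5) : E h :=
  ⟨Projectivization.mk ℚ (coord i) (coord_ne_zero i), fun p hp ↦ by
    rw [Projectivization.submodule_mk, Submodule.mem_span_singleton] at hp
    obtain ⟨c, rfl⟩ := hp
    rw [cubic_smul, cubic_coord, mul_zero]⟩

theorem coord_mem (h : ℚ) (i : ZMod 5) : coord i ∈ (torsionPoint h i).1.submodule := by
  rw [torsionPoint, Projectivization.submodule_mk]
  exact Submodule.mem_span_singleton_self _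

theorem eq_of_coord_eq_smul {i j : ZMod 5} {c : ℚ} (hc : coord j = c • coord i) : i = j := by
  have h0 : coord j 0 = c * coord i 0 := congrFun hc 0
  have h1 : coord j 1 = c * coord i 1 := congrFun hc 1
  have h2 : coord j 2 = c * coord i 2 := congrFun hc 2
  clear hc
  fin_cases i <;> fin_cases j <;> first
    | rfl
    | simp only [coord, Fin.reduceFinMk, Fin.zero_eta, Fin.mk_one, Matrix.cons_val] at h0 h1 h2
      grind

theorem torsionPoint_injective : Function.Injective (torsionPoint h) := by
  intro i j hij
  obtain ⟨c, hc⟩ := exists_eq_smul_of_mem_submodule (coord_ne_zero i) (coord_mem h i)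
    (hij ▸ coord_mem h j)
  exact eq_of_coord_eq_smul hc

theorem torsionPoint_zero : torsionPoint h 0 = O h := rfl

theorem gradient_coord (h : ℚ) (i : ZMod 5) : gradient h (coord i) =
    (![![-1, -1, h - 1], ![1, 0, 1], ![h, 0, 0], ![0, h, 0], ![0, 1, 1]] :
      Fin 5 → Fin 3 → ℚ) i := by
  fin_cases i <;> ext l <;> fin_cases l <;> simp [coord, gradient]
  ring

theorem gradient_coord_ne_zero (hh : h ≠ 0) (i : ZMod 5) : gradient h (coord i) ≠ 0 := by
  rw [gradient_coord]
  intro h0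
  fin_cases i
  · simpa using congrFun h0 0
  · simpa using congrFun h0 0
  · simpa [hh] using congrFun h0 0
  · simpa [hh] using congrFun h0 1
  · simpa using congrFun h0 1

theorem gradient_coord_dotProduct_coord (h : ℚ) (i j : ZMod 5) :
    gradient h (coord i) ⬝ᵥ coord j =
      (![![0, -1, h, h, -1], ![1, 0, 1, 0, 1], ![h, 0, 0, -h, h], ![-h, h, -h, 0, 0],
        ![-1, 1, 0, 1, 0]] : Fin 5 → Fin 5 → ℚ) i j := by
  rw [gradient_coord]
  fin_cases i <;> fin_cases j <;> simp [coord, dotProduct, Fin.sum_univ_three]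

theorem gradient_coord_dotProduct_coord_neg_two_mul (h : ℚ) (i : ZMod 5) :
    gradient h (coord i) ⬝ᵥ coord (-(2 * i)) = 0 := by
  rw [gradient_coord_dotProduct_coord]
  fin_cases i <;> rfl

theorem exists_chordPoint_coord_eq (hh : h ≠ 0) {i j : ZMod 5} (hij : i ≠ j) :
    ∃ c : ℚ, c ≠ 0 ∧ chordPoint h (coord i) (coord j) = c • coord (-(i + j)) := by
  let c : Fin 5 → Fin 5 → ℚ :=
    ![![0, 1, -h, -h, 1], ![-1, 0, -1, h, -1], ![h, 1, 0, -h, -h], ![h, -h, h, 0, 1],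
      ![-1, 1, h, -1, 0]]
  refine ⟨c i j, ?_, ?_⟩
  · fin_cases i <;> fin_cases j <;> first | exact absurd rfl hij | simp [c, hh]
  have neg_add_eq : ∀ i j : Fin 5, -(i + j) = ![![0, 4, 3, 2, 1], ![4, 3, 2, 1, 0],
      ![3, 2, 1, 0, 4], ![2, 1, 0, 4, 3], ![1, 0, 4, 3, 2]] i j := by decide
  rw [show -(i + j) = _ from neg_add_eq i j, chordPoint, gradient_coord_dotProduct_coord,
    gradient_coord_dotProduct_coord]
  ext l
  fin_cases i <;> fin_cases j <;> fin_cases l <;>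
    first | exact absurd rfl hij | simp [coord, c]

theorem lineMeets_torsionPoint_iff_of_ne (hh : h ≠ 0) {i j : ZMod 5} (hij : i ≠ j) (k : ZMod 5) :
    LineMeets h (torsionPoint h i) (torsionPoint h j) (torsionPoint h k) ↔ i + j + k = 0 := by
  obtain ⟨c, hc, hcp⟩ := exists_chordPoint_coord_eq hh hij
  rw [lineMeets_iff_of_ne (torsionPoint_injective.ne hij) (coord_ne_zero i) (coord_ne_zero j)
    (coord_mem h i) (coord_mem h j), hcp, Submodule.smul_mem_iff _ hc,
    and_iff_right (smul_ne_zero hc (coord_ne_zero _)), ← neg_eq_iff_add_eq_zero]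
  constructor
  · exact fun hk ↦ torsionPoint_injective
      (eq_of_mem_submodule (coord_ne_zero _) (coord_mem h _) hk)
  · rintro rfl
    exact coord_mem h _

theorem lineMeets_torsionPoint_self_iff (hh : h ≠ 0) (i : ZMod 5) :
    LineMeets h (torsionPoint h i) (torsionPoint h i) (torsionPoint h i) ↔ i = 0 := by
  constructor
  · intro H
    have h2 := torsionPoint_injective <| H.eq_of_dotProduct_eq_zero (coord_ne_zero i)
      (coord_ne_zero _) (coord_mem h i) (coord_mem h _) (gradient_coord_ne_zero hh i)
      (gradient_coord_dotProduct_coord_neg_two_mul h i)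
    exact (by decide : ∀ i : ZMod 5, -(2 * i) = i → i = 0) i h2
  · rintro rfl
    refine ⟨coord 0, ![h - 1, 0, 1], ?_, ![1, 0], ![1, 0], ![1, 0], by simp, by simp, by simp,
      ?_, ?_, ?_, -h ^ 2, by simpa, fun s t ↦ ?_⟩
    · refine LinearIndependent.pair_iff.2 fun s t hst ↦ ?_
      have ht : s * 0 + t * 1 = 0 := congrFun hst 2
      have hs : s * -1 + t * 0 = 0 := congrFun hst 1
      constructor <;> linarith
    · simpa using coord_mem h 0
    · simpa using coord_mem h 0
    · simpa using coord_mem h 0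
    · simp [cubic, coord]
      ring

theorem lineMeets_torsionPoint_iff (hh : h ≠ 0) (i j k : ZMod 5) :
    LineMeets h (torsionPoint h i) (torsionPoint h j) (torsionPoint h k) ↔ i + j + k = 0 := by
  rcases ne_or_eq i j with hij | rfl
  · exact lineMeets_torsionPoint_iff_of_ne hh hij k
  rcases ne_or_eq i k with hik | rfl
  · rw [add_rotate, ← lineMeets_torsionPoint_iff_of_ne hh hik i]
    exact ⟨LineMeets.rotate, fun H ↦ H.rotate.rotate⟩
  rw [lineMeets_torsionPoint_self_iff hh]
  revert i
  decide

theorem exists_eq_smul_coord {p : Fin 3 → ℚ} (hp : cubic h p = 0) (h0 : p 0 * p 1 * p 2 = 0) :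
    ∃ (i : ZMod 5) (c : ℚ), p = c • coord i := by
  have of_coord_eq {a b d : ℚ} (i : ZMod 5) (c : ℚ) (hi : coord i = ![a, b, d])
      (ha : p 0 = c * a) (hb : p 1 = c * b) (hd : p 2 = c * d) :
      ∃ (i : ZMod 5) (c : ℚ), p = c • coord i :=
    ⟨i, c, by rw [hi]; ext j; fin_cases j <;> assumption⟩
  rw [cubic] at hp
  obtain (h0 | h1) | h2 : (p 0 = 0 ∨ p 1 = 0) ∨ p 2 = 0 := by simpa only [mul_eq_zero] using h0
  · obtain h2 | h12 : p 2 = 0 ∨ p 1 + p 2 = 0 := by simpa [h0, or_assoc] using hp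
    · exact of_coord_eq 1 (p 1) rfl (by simp [h0]) (by simp) (by simp [h2])
    · exact of_coord_eq 2 (p 2) rfl (by simp [h0]) (by linarith) (by simp)
  · obtain h02 | h2 : p 0 + p 2 = 0 ∨ p 2 = 0 := by
      simpa [h1, or_comm, or_left_comm] using hp
    · exact of_coord_eq 3 (p 2) rfl (by linarith) (by simp [h1]) (by simp)
    · exact of_coord_eq 4 (p 0) rfl (by simp) (by simp [h1]) (by simp [h2])
  · obtain (h0 | h1) | h01 : (p 0 = 0 ∨ p 1 = 0) ∨ p 0 + p 1 = 0 := by simpa [h2] using hp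
    · exact of_coord_eq 1 (p 1) rfl (by simp [h0]) (by simp) (by simp [h2])
    · exact of_coord_eq 4 (p 0) rfl (by simp) (by simp [h1]) (by simp [h2])
    · exact of_coord_eq 0 (p 0) rfl (by simp) (by linarith) (by simp [h2])

theorem torsionPoint_surjective (H : ∀ x y : ℚ, (x + 1) * (y + 1) * (x + y + 1) = h * x * y →
    x * y = 0) : Function.Surjective (torsionPoint h) := by
  intro P
  have hP := P.2 _ (rep_mem_submodule P)
  have h0 : P.1.rep 0 * P.1.rep 1 * P.1.rep 2 = 0 := by
    rw [mul_eq_zero, or_iff_not_imp_right]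
    intro h2
    have hxy := H (P.1.rep 0 / P.1.rep 2) (P.1.rep 1 / P.1.rep 2) (by
      rw [cubic] at hP
      field_simp
      linear_combination hP)
    rw [div_mul_div_comm, div_eq_zero_iff] at hxy
    exact hxy.resolve_right (mul_ne_zero h2 h2)
  obtain ⟨i, c, hc⟩ := exists_eq_smul_coord hP h0
  refine ⟨i, eq_of_mem_submodule P.1.rep_nonzero ?_ (rep_mem_submodule P)⟩
  rw [hc]
  exact Submodule.smul_mem _ c (coord_mem h i)

theorem exists_isChordTangentLaw (hh : h ≠ 0) (hsurj : Function.Surjective (torsionPoint h)) :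
    ∃ G : AddCommGroup (E h), IsChordTangentLaw h G ∧ Module.rank ℤ (E h) = 0 ∧
      Nonempty (E h ≃+ ZMod 5) := by
  let φ : E h ≃ ZMod 5 := (Equiv.ofBijective (torsionPoint h) ⟨torsionPoint_injective, hsurj⟩).symm
  let G : AddCommGroup (E h) := φ.addCommGroup
  have φ_add (P Q : E h) : φ (P + Q) = φ P + φ Q := φ.addEquiv.map_add P Q
  have φ_zero : φ 0 = 0 := φ.addEquiv.map_zero
  have torsionPoint_φ (P : E h) : torsionPoint h (φ P) = P := φ.symm_apply_apply P
  refine ⟨G, ⟨?_, fun P Q R ↦ ?_⟩, rank_eq_zero_iff.2 fun P ↦ ⟨5, by norm_num, ?_⟩, ⟨φ.addEquiv⟩⟩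
  · rw [← torsionPoint_zero, ← φ_zero, torsionPoint_φ]
  · rw [← φ.injective.eq_iff, φ_add, φ_add, φ_zero, ← lineMeets_torsionPoint_iff hh,
      torsionPoint_φ, torsionPoint_φ, torsionPoint_φ]
  · apply φ.addEquiv.injective
    rw [map_zsmul, map_zero, zsmul_eq_mul]
    exact zero_mul _

end Torsion

theorem hcPlus_lt : hcPlus < ((13 : ℚ) : ℝ) := by
  have : Real.sqrt 5 < 3 := (Real.sqrt_lt' (by norm_num)).2 (by norm_num)
  rw [hcPlus]
  push_cast
  linarith

theorem torsionPoint_thirteen_surjective : Function.Surjective (torsionPoint 13) :=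
  torsionPoint_surjective fun _ _ ↦ mul_eq_zero_of_curve

end Lyness

theorem mainTheorem7 :
    (∃ h : ℚ, Lyness.hcPlus < (h : ℝ) ∧
      ∃ G : AddCommGroup (Lyness.E h), Lyness.IsChordTangentLaw h G ∧
        Module.rank ℤ (Lyness.E h) = 0) ∧
    (Lyness.hcPlus < ((13 : ℚ) : ℝ) ∧
      ∃ G : AddCommGroup (Lyness.E 13), Lyness.IsChordTangentLaw 13 G ∧
        Module.rank ℤ (Lyness.E 13) = 0 ∧ Nonempty (Lyness.E 13 ≃+ ZMod 5)) ∧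
    ¬ (∀ h : ℚ, Lyness.hcPlus < (h : ℝ) →
      ∀ G : AddCommGroup (Lyness.E h), Lyness.IsChordTangentLaw h G →
        0 < Module.rank ℤ (Lyness.E h)) := by
  obtain ⟨G, hG, hrank, he⟩ := Lyness.exists_isChordTangentLaw (h := 13) (by norm_num)
    Lyness.torsionPoint_thirteen_surjective
  exact ⟨⟨13, Lyness.hcPlus_lt, G, hG, hrank⟩, ⟨Lyness.hcPlus_lt, G, hG, hrank, he⟩,
    fun H ↦ (H 13 Lyness.hcPlus_lt G hG).ne' hrank⟩
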